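/- Let $n\ge 1$ and $Y=(0,1)^n$. For $k\in\mathbb N$, $L^2_{\mathrm{per}}(Y)$ and $H^k_{\mathrm{per}}(Y)$ denote the spaces of $Y$-periodic functions that are square integrable over $Y$, respectively that have in addition $Y$-periodic weak derivatives up to order $k$ that are square integrable over $Y$; functions are identified if they agree almost everywhere. Let $H^1_{\mathrm{per},0}(Y;\mathbb R^n)$ be the space of $v\in H^1_{\mathrm{per}}(Y;\mathbb R^n)$ with $\int_Y v=0$, equipped with the $H^1(Y)$-norm, and let $(Dv)_{ij}=\partial_j v_i$. Let $A\in L^\infty_{\mathrm{per}}(Y;\mathbb R^{n\times n}_{\mathrm{sym}})$ and $b\in L^\infty_{\mathrm{per}}(Y;\mathbb R^n)$ be such that $\lambda I_n\le A\le\Lambda I_n$ a.e. in $\mathbb R^n$ for some $\lambda,\Lambda>0$, and such that for some $\delta\in\left(\frac{n}{n+\pi^2},1\right]$ $$\frac{|A|^2+|b|^2}{(\mathrm{tr}(A))^2}\le\frac{1}{n-1+\delta}\quad\text{a.e. in }\mathbb R^n,$$ where $|A|^2=A:A$ and $|b|^2=b\cdot b$. Set $$\gamma=\frac{\mathrm{tr}(A)}{|A|^2+|b|^2},\qquad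 \tilde A=\gamma A,\qquad \tilde b=\gamma b,$$ and for $v,w\in H^1_{\mathrm{per},0}(Y;\mathbb R^n)$ define $$B_2(v,w)=\int_Y(\nabla\cdot v)\left(\tilde A:Dw+\tilde b\cdot w\right)+\frac12\int_Y\left(Dv-(Dv)^{\mathrm T}\right):\left(Dw-(Dw)^{\mathrm T}\right).$$ Then $B_2$ is a bounded and coercive bilinear form on $H^1_{\mathrm{per},0}(Y;\mathbb R^n)$. There exists a unique $\rho\in H^1_{\mathrm{per},0}(Y;\mathbb R^n)$ such that $$B_2(\rho,w)=\int_Y\left(\tilde A:Dw+\tilde b\cdot w\right)\qquad\forall w\in H^1_{\mathrm{per},0}(Y;\mathbb R^n).$$ Moreover, there is exactly one $\tilde r\in L^2_{\mathrm{per}}(Y)$ with $\int_Y\tilde r=1$ and $$\int_Y\tilde r\left(\tilde A:D^2\varphi+\tilde b\cdot\nabla\varphi\right)=0\qquad\forall\varphi\in H^2_{\mathrm{per}}(Y)$$ (that is, one very weak $Y$-periodic solution of $-D^2:(\tilde A\tilde r)+\nabla\cdot(\tilde b\tilde r)=0$ in $Y$ with $\int_Y\tilde r=1$), and it is given by $\tilde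 r=1-\nabla\cdot\rho$. -/

import Mathlib

open MeasureTheory
open scoped ContDiff Matrix

noncomputable section

namespace PeriodicFPK

/-- The open unit cell `Y = (0,1)^n` of `ℝ^n`. -/
def unitCell (n : ℕ) : Set (Fin n → ℝ) := Set.univ.pi fun _ => Set.Ioo (0 : ℝ) 1

/-- `L²_per(Y)`. A `Y`-periodic function is determined almost everywhere by its restriction to `Y`,
and every function on `Y` has a `Y`-periodic extension, unique up to null sets; accordingly
`L²_per(Y)` is the space `L²(Y)` of classes of square integrable functions on `Y`. -/
abbrev L2per (n : ℕ) : Type := Lp ℝ 2 ((volume : Measure (Fin n → ℝ)).restrict (unitCell n))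

/-- `C^∞_per(Y)`: smooth functions on the whole of `ℝ^n` that have period `1` in each coordinate. -/
structure IsSmoothPeriodic {n : ℕ} (φ : (Fin n → ℝ) → ℝ) : Prop where
  smooth : ContDiff ℝ ∞ φ
  periodic : ∀ (i : Fin n) (x : Fin n → ℝ), φ (x + Pi.single i 1) = φ x

/-- The classical partial derivative `∂_i φ`. -/
def partialDeriv {n : ℕ} (i : Fin n) (φ : (Fin n → ℝ) → ℝ) (x : Fin n → ℝ) : ℝ :=
  fderiv ℝ φ x (Pi.single i 1)

/-- `g = ∂_i u` weakly (for the `Y`-periodic extensions of `u` and `g`):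
`∫_Y u ∂_i φ = - ∫_Y g φ` for all `φ ∈ C^∞_per(Y)`. -/
def IsWeakPartial {n : ℕ} (i : Fin n) (u g : L2per n) : Prop :=
  ∀ φ : (Fin n → ℝ) → ℝ, IsSmoothPeriodic φ →
    ∫ x in unitCell n, u x * partialDeriv i φ x = - ∫ x in unitCell n, g x * φ x

/-! Closure of weak differentiability and of the zero mean condition under linear combinations. -/

theorem integrable_mul_continuous {n : ℕ} (u : L2per n) {ψ : (Fin n → ℝ) → ℝ}
    (hψ : Continuous ψ) :
    Integrable (fun x => u x * ψ x) (volume.restrict (unitCell n)) := by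
  have hsub : unitCell n ⊆ Set.Icc (0 : Fin n → ℝ) 1 := fun x hx => by
    simp only [unitCell, Set.mem_univ_pi, Set.mem_Ioo] at hx
    exact ⟨fun i => (hx i).1.le, fun i => (hx i).2.le⟩
  have hfin : IsFiniteMeasure ((volume : Measure (Fin n → ℝ)).restrict (unitCell n)) :=
    ⟨by
      rw [Measure.restrict_apply_univ]
      exact (measure_mono hsub).trans_lt isCompact_Icc.measure_lt_top⟩
  obtain ⟨C, hC⟩ := (isCompact_Icc (a := (0 : Fin n → ℝ)) (b := 1)).exists_bound_of_continuousOn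
    hψ.continuousOn
  have hu : Integrable (fun x => u x) (volume.restrict (unitCell n)) :=
    (Lp.memLp u).integrable (by norm_num)
  have hm : MeasurableSet (unitCell n) := MeasurableSet.univ_pi fun _ => measurableSet_Ioo
  exact hu.mul_bdd (c := C) hψ.aestronglyMeasurable
    ((ae_restrict_iff' hm).2 (Filter.Eventually.of_forall fun x hx => hC x (hsub hx)))

theorem integral_add_mul {n : ℕ} (u v : L2per n) {ψ : (Fin n → ℝ) → ℝ} (hψ : Continuous ψ) :
    ∫ x in unitCell n, (u + v : L2per n) x * ψ x =
      (∫ x in unitCell n, u x * ψ x) + ∫ x in unitCell n, v x * ψ x := by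
  rw [← integral_add (integrable_mul_continuous u hψ) (integrable_mul_continuous v hψ)]
  refine integral_congr_ae ?_
  filter_upwards [Lp.coeFn_add u v] with x hx
  rw [hx, Pi.add_apply, add_mul]

theorem integral_smul_mul {n : ℕ} (c : ℝ) (u : L2per n) (ψ : (Fin n → ℝ) → ℝ) :
    ∫ x in unitCell n, (c • u : L2per n) x * ψ x = c * ∫ x in unitCell n, u x * ψ x := by
  rw [← integral_const_mul]
  refine integral_congr_ae ?_
  filter_upwards [Lp.coeFn_smul c u] with x hx
  rw [hx, Pi.smul_apply, smul_eq_mul, mul_assoc]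

theorem IsSmoothPeriodic.continuous_partialDeriv {n : ℕ} {φ : (Fin n → ℝ) → ℝ}
    (hφ : IsSmoothPeriodic φ) (i : Fin n) : Continuous (partialDeriv i φ) :=
  (hφ.smooth.continuous_fderiv (by simp)).clm_apply continuous_const

theorem IsWeakPartial.add {n : ℕ} {i : Fin n} {u g v h : L2per n}
    (hu : IsWeakPartial i u g) (hv : IsWeakPartial i v h) : IsWeakPartial i (u + v) (g + h) := by
  intro φ hφ
  rw [integral_add_mul u v (hφ.continuous_partialDeriv i),
    integral_add_mul g h hφ.smooth.continuous, hu φ hφ, hv φ hφ, neg_add]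

theorem IsWeakPartial.smul {n : ℕ} {i : Fin n} (c : ℝ) {u g : L2per n}
    (hu : IsWeakPartial i u g) : IsWeakPartial i (c • u) (c • g) := by
  intro φ hφ
  rw [integral_smul_mul, integral_smul_mul, hu φ hφ, mul_neg]

theorem integral_add_eq {n : ℕ} (u v : L2per n) :
    ∫ x in unitCell n, (u + v : L2per n) x =
      (∫ x in unitCell n, u x) + ∫ x in unitCell n, v x := by
  simpa using integral_add_mul u v (continuous_const (y := (1 : ℝ)))

theorem integral_smul_eq {n : ℕ} (c : ℝ) (u : L2per n) :
    ∫ x in unitCell n, (c • u : L2per n) x = c * ∫ x in unitCell n, u x := by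
  simpa using integral_smul_mul c u fun _ => 1

/-- The Hilbert space `L²_per(Y;ℝ^n) × L²_per(Y;ℝ^{n×n})`, with
`‖(v, G)‖² = ∑ i, ‖v i‖² + ∑ i j, ‖G (i, j)‖²`. -/
abbrev FieldWithGrad (n : ℕ) : Type :=
  WithLp 2 (PiLp 2 (fun _ : Fin n => L2per n) × PiLp 2 (fun _ : Fin n × Fin n => L2per n))

/-- `H¹_{per,0}(Y;ℝ^n)`: vector fields with `Y`-periodic weak derivatives in `L²` and zero mean.
An element is recorded as the pair `(v, Dv)`, `(Dv)_{ij} = ∂_j v_i`; since weak derivatives are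
unique this is the field `v` itself, and the norm inherited from `FieldWithGrad n` is the `H¹` norm
`(‖v‖²_{L²} + ‖Dv‖²_{L²})^{1/2}`. -/
def H1perZero (n : ℕ) : Submodule ℝ (FieldWithGrad n) where
  carrier := {u | (∀ i j, IsWeakPartial j (u.fst i) (u.snd (i, j))) ∧
    ∀ i, ∫ x in unitCell n, u.fst i x = 0}
  zero_mem' := by
    refine ⟨fun i j => ?_, fun i => ?_⟩
    · have h : IsWeakPartial j ((0 : ℝ) • (0 : L2per n)) ((0 : ℝ) • (0 : L2per n)) := by
        intro φ _
        rw [integral_smul_mul, integral_smul_mul, zero_mul, zero_mul, neg_zero]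
      rw [smul_zero] at h
      exact h
    · have h := integral_smul_eq (0 : ℝ) (0 : L2per n)
      rw [smul_zero, zero_mul] at h
      exact h
  add_mem' := by
    rintro u v ⟨hu, hu'⟩ ⟨hv, hv'⟩
    refine ⟨fun i j => (hu i j).add (hv i j), fun i => ?_⟩
    have h := integral_add_eq (u.fst i) (v.fst i)
    rw [hu' i, hv' i, add_zero] at h
    exact h
  smul_mem' := by
    rintro c u ⟨hu, hu'⟩
    refine ⟨fun i j => (hu i j).smul c, fun i => ?_⟩
    have h := integral_smul_eq c (u.fst i)
    rw [hu' i, mul_zero] at h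
    exact h

/-- The component `v_i`. -/
def comp {n : ℕ} (v : H1perZero n) (i : Fin n) : L2per n := v.1.fst i

/-- The entry `(Dv)_{ij} = ∂_j v_i`. -/
def grad {n : ℕ} (v : H1perZero n) (i j : Fin n) : L2per n := v.1.snd (i, j)

/-- The divergence `∇·v = ∑ i, ∂_i v_i` (as a function on `Y`). -/
def div {n : ℕ} (v : H1perZero n) (x : Fin n → ℝ) : ℝ := ∑ i, grad v i i x

/-- `A : G + b · p` at the point `x`. -/
def firstOrderTerm {n : ℕ} (A : (Fin n → ℝ) → Matrix (Fin n) (Fin n) ℝ)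
    (b : (Fin n → ℝ) → Fin n → ℝ) (G : Fin n → Fin n → L2per n) (p : Fin n → L2per n)
    (x : Fin n → ℝ) : ℝ :=
  (∑ i, ∑ j, A x i j * G i j x) + ∑ i, b x i * p i x

/-- `B(v,w) = ∫_Y (∇·v)(A:Dw + b·w) + ½ ∫_Y (Dv - Dvᵀ):(Dw - Dwᵀ)`. -/
def bilinForm {n : ℕ} (A : (Fin n → ℝ) → Matrix (Fin n) (Fin n) ℝ)
    (b : (Fin n → ℝ) → Fin n → ℝ) (v w : H1perZero n) : ℝ :=
  (∫ x in unitCell n, div v x * firstOrderTerm A b (grad w) (comp w) x) +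
    (1 / 2) * ∫ x in unitCell n,
      ∑ i, ∑ j, (grad v i j x - grad v j i x) * (grad w i j x - grad w j i x)

/-- `A : A + b · b`, that is `|A|² + |b|²`, at the point `x`. -/
def sqNorm {n : ℕ} (A : (Fin n → ℝ) → Matrix (Fin n) (Fin n) ℝ)
    (b : (Fin n → ℝ) → Fin n → ℝ) (x : Fin n → ℝ) : ℝ :=
  (∑ i, ∑ j, A x i j ^ 2) + ∑ i, b x i ^ 2

/-- `(A, b) ∈ 𝓑`: essentially bounded `Y`-periodic coefficients on `ℝ^n` with `A` symmetric and
uniformly elliptic, satisfying the Cordes-type condition. -/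
structure SettingB {n : ℕ} (A : (Fin n → ℝ) → Matrix (Fin n) (Fin n) ℝ)
    (b : (Fin n → ℝ) → Fin n → ℝ) : Prop where
  memLp_A : ∀ i j, MemLp (fun x => A x i j) ⊤ volume
  memLp_b : ∀ i, MemLp (fun x => b x i) ⊤ volume
  periodic_A : ∀ k : Fin n, ∀ᵐ x, A (x + Pi.single k 1) = A x
  periodic_b : ∀ k : Fin n, ∀ᵐ x, b (x + Pi.single k 1) = b x
  symm_A : ∀ᵐ x, (A x).IsSymm
  elliptic : ∃ lam Lam : ℝ, 0 < lam ∧ 0 < Lam ∧ ∀ᵐ x, ∀ ξ : Fin n → ℝ,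
    lam * (ξ ⬝ᵥ ξ) ≤ ξ ⬝ᵥ (A x *ᵥ ξ) ∧ ξ ⬝ᵥ (A x *ᵥ ξ) ≤ Lam * (ξ ⬝ᵥ ξ)
  cordes : ∃ δ : ℝ, n / (n + Real.pi ^ 2) < δ ∧ δ ≤ 1 ∧
    ∀ᵐ x, sqNorm A b x / (A x).trace ^ 2 ≤ 1 / (n - 1 + δ)

/-- The renormalization function `γ = tr(A) / (|A|² + |b|²)`. -/
def gam {n : ℕ} (A : (Fin n → ℝ) → Matrix (Fin n) (Fin n) ℝ)
    (b : (Fin n → ℝ) → Fin n → ℝ) (x : Fin n → ℝ) : ℝ :=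
  (A x).trace / sqNorm A b x

/-- The renormalized diffusion matrix `Ã = γ A`. -/
def renormA {n : ℕ} (A : (Fin n → ℝ) → Matrix (Fin n) (Fin n) ℝ)
    (b : (Fin n → ℝ) → Fin n → ℝ) (x : Fin n → ℝ) : Matrix (Fin n) (Fin n) ℝ :=
  gam A b x • A x

/-- The renormalized drift `b̃ = γ b`. -/
def renormb {n : ℕ} (A : (Fin n → ℝ) → Matrix (Fin n) (Fin n) ℝ)
    (b : (Fin n → ℝ) → Fin n → ℝ) (x : Fin n → ℝ) : Fin n → ℝ :=
  gam A b x • b x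

/-- `u ∈ L²_per(Y)` is a (very weak) `Y`-periodic solution of `-D²:(A u) + ∇·(b u) = 0` in `Y`:
`∫_Y u (A : D²φ + b · ∇φ) = 0` for all `φ ∈ H²_per(Y)`. Here `φ ∈ H²_per(Y)` is given together with
its weak gradient `p` and its weak Hessian `H`. -/
def IsVeryWeakSolution {n : ℕ} (A : (Fin n → ℝ) → Matrix (Fin n) (Fin n) ℝ)
    (b : (Fin n → ℝ) → Fin n → ℝ) (u : L2per n) : Prop :=
  ∀ (φ : L2per n) (p : Fin n → L2per n) (H : Fin n → Fin n → L2per n),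
    (∀ i, IsWeakPartial i φ (p i)) → (∀ i j, IsWeakPartial j (p i) (H i j)) →
      ∫ x in unitCell n, u x * firstOrderTerm A b H p x = 0

end PeriodicFPK

end

noncomputable section

namespace PeriodicFPK

/-! Write `T w = Ã : Dw + b̃ · w`. The factor `γ` minimizes `c ↦ |cA - I|² + |cb|²`, and the minimum
is `n - tr(A)²/(|A|² + |b|²)`. The Cordes condition bounds it by `ε = 1 - δ`, so `T w` differs from
`∇·w = I : Dw` by at most `√ε ‖w‖` in `L²`.

For periodic fields `½‖Dw - Dwᵀ‖² = ‖Dw‖² - ‖∇·w‖²` (`half_norm_sq_skew`). Hence `B₂(w,w) = ‖Dw‖² +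
⟨∇·w, T w - ∇·w⟩`, where `‖∇·w‖ ≤ ‖Dw‖`. The periodic Poincaré inequality gives `‖w‖² ≤ K ‖Dw‖²`
with `K = 1 + 1/(4π²)`. The lower bound on `δ` forces `εK < 1`, so the error term is absorbed and
`B₂` is coercive (`IsNearIdentity.coercive`). Lax–Milgram then yields `ρ`.

The skew part of `B₂(·,w)` vanishes when `w = ∇φ`. The equation for `ρ` therefore says that `1 -
∇·ρ` is orthogonal to `T ∇φ` for every `φ ∈ H²_per`, and its mean is `1` because a divergence has
zero mean. For uniqueness, the difference `q` of two solutions has zero mean, so `q = Δφ` with `φ ∈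
H²_per` (`exists_poisson`). With `v = ∇φ` one gets `B₂(v,v) = ∫ q T v = 0`, so `v = 0` and `q = ∇·v
= 0`.

The facts about periodic Sobolev functions are read off from Fourier coefficients, since `g = ∂_j u`
weakly exactly when `ĝ(k) = 2πi k_j û(k)` for all `k` (`isWeakPartial_iff_coeff`). -/

open scoped ComplexConjugate

/-! ### The Fourier basis of the cell, transported from the torus -/

/-- Lebesgue measure on the unit cell. -/
abbrev cellMeasure (n : ℕ) : Measure (Fin n → ℝ) := volume.restrict (unitCell n)

/-- Normalized Haar measure on the torus `(ℝ/ℤ)^n`. -/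
abbrev torusMeasure (n : ℕ) : Measure (UnitAddTorus (Fin n)) :=
  Measure.pi fun _ => AddCircle.haarAddCircle

/-- The covering map of the torus. -/
def toTorus {n : ℕ} (x : Fin n → ℝ) : UnitAddTorus (Fin n) := fun i => (x i : UnitAddCircle)

/-- The section of the covering map with values in `(0,1]^n`. -/
def ofTorus {n : ℕ} (y : UnitAddTorus (Fin n)) : Fin n → ℝ :=
  fun i => (AddCircle.measurableEquivIoc 1 0 (y i) : ℝ)

theorem measurableSet_unitCell (n : ℕ) : MeasurableSet (unitCell n) :=
  MeasurableSet.univ_pi fun _ => measurableSet_Ioo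

theorem unitCell_ae_eq_Icc (n : ℕ) :
    unitCell n =ᵐ[volume] Set.Icc (0 : Fin n → ℝ) 1 :=
  Measure.univ_pi_Ioo_ae_eq_Icc (f := fun _ => (0 : ℝ)) (g := fun _ => 1)

instance isProbabilityMeasure_cell (n : ℕ) : IsProbabilityMeasure (cellMeasure n) :=
  ⟨by simp [unitCell, Real.volume_pi_Ioo]⟩

/-- In one dimension the quotient map sends Lebesgue measure on a period to Haar measure; endpoints
are null, so the open interval serves as well. The general case is the product of `n` copies. -/
theorem measurePreserving_toTorus (n : ℕ) :
    MeasurePreserving (toTorus (n := n)) (cellMeasure n) (torusMeasure n) := by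
  have h1 : MeasurePreserving (QuotientAddGroup.mk : ℝ → UnitAddCircle)
      (volume.restrict (Set.Ioo (0 : ℝ) 1)) AddCircle.haarAddCircle := by
    have h := AddCircle.measurePreserving_mk (1 : ℝ) 0
    rw [AddCircle.volume_eq_smul_haarAddCircle, ENNReal.ofReal_one, one_smul, zero_add,
      ← Measure.restrict_congr_set Ioo_ae_eq_Ioc] at h
    exact h
  have h2 := measurePreserving_pi (fun _ : Fin n => volume.restrict (Set.Ioo (0 : ℝ) 1))
    (fun _ => AddCircle.haarAddCircle) (fun _ => h1)
  rw [← Measure.restrict_pi_pi] at h2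
  exact h2

theorem measurable_ofTorus (n : ℕ) : Measurable (ofTorus (n := n)) :=
  measurable_pi_lambda _ fun i => measurable_subtype_coe.comp
    ((AddCircle.measurableEquivIoc 1 0).measurable.comp (measurable_pi_apply i))

theorem ofTorus_toTorus_ae (n : ℕ) : ∀ᵐ x ∂cellMeasure n, ofTorus (toTorus x) = x := by
  refine (ae_restrict_iff' (measurableSet_unitCell n)).2 (Filter.Eventually.of_forall ?_)
  intro x hx
  funext i
  have hi : x i ∈ Set.Ioo (0 : ℝ) 1 := hx i (Set.mem_univ i)
  exact AddCircle.equivIoc_coe_of_mem (p := (1 : ℝ)) (a := 0)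
    (by rw [zero_add]; exact ⟨hi.1, hi.2.le⟩)

theorem measurePreserving_ofTorus (n : ℕ) :
    MeasurePreserving (ofTorus (n := n)) (torusMeasure n) (cellMeasure n) := by
  refine ⟨measurable_ofTorus n, ?_⟩
  rw [← (measurePreserving_toTorus n).map_eq,
    Measure.map_map (measurable_ofTorus n) (measurePreserving_toTorus n).measurable]
  have h : ofTorus ∘ toTorus =ᵐ[cellMeasure n] id := ofTorus_toTorus_ae n
  rw [Measure.map_congr h, Measure.map_id]

/-- Square integrable functions on the torus are square integrable functions on the unit cell. -/
def torusToCell (n : ℕ) : Lp ℂ 2 (torusMeasure n) ≃ₗᵢ[ℂ] Lp ℂ 2 (cellMeasure n) :=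
  LinearIsometryEquiv.ofSurjective
    (Lp.compMeasurePreservingₗᵢ ℂ toTorus (measurePreserving_toTorus n)) (by
      intro v
      refine ⟨Lp.compMeasurePreserving ofTorus (measurePreserving_ofTorus n) v, ?_⟩
      refine Lp.ext ?_
      refine (Lp.coeFn_compMeasurePreserving _ (measurePreserving_toTorus n)).trans ?_
      have h := (measurePreserving_toTorus n).quasiMeasurePreserving.ae_eq_comp
        (Lp.coeFn_compMeasurePreserving v (measurePreserving_ofTorus n))
      refine h.trans ?_
      filter_upwards [ofTorus_toTorus_ae n] with x hx
      simp [hx])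

/-- The Fourier basis of `L²(Y;ℂ)`. -/
def cellBasis (n : ℕ) : HilbertBasis (Fin n → ℤ) ℂ (Lp ℂ 2 (cellMeasure n)) :=
  HilbertBasis.ofRepr ((torusToCell n).symm.trans UnitAddTorus.mFourierBasis.repr)

/-- The character `x ↦ exp(2πi k·x)`. -/
def character {n : ℕ} (k : Fin n → ℤ) (x : Fin n → ℝ) : ℂ :=
  Complex.exp (2 * Real.pi * Complex.I * ((∑ j, (k j : ℝ) * x j : ℝ) : ℂ))

theorem mFourier_toTorus {n : ℕ} (k : Fin n → ℤ) (x : Fin n → ℝ) :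
    UnitAddTorus.mFourier k (toTorus x) = character k x := by
  simp only [UnitAddTorus.mFourier, ContinuousMap.coe_mk, toTorus, fourier_coe_apply, character]
  rw [← Complex.exp_sum]
  congr 1
  push_cast
  rw [Finset.mul_sum]
  refine Finset.sum_congr rfl fun j _ => ?_
  ring

theorem coeFn_cellBasis {n : ℕ} (k : Fin n → ℤ) :
    cellBasis n k =ᵐ[cellMeasure n] character k := by
  have h : cellBasis n k = torusToCell n (UnitAddTorus.mFourierLp 2 k) := by
    rw [← UnitAddTorus.coe_mFourierBasis]
    rfl
  rw [h]
  refine (Lp.coeFn_compMeasurePreserving _ (measurePreserving_toTorus n)).trans ?_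
  refine ((measurePreserving_toTorus n).quasiMeasurePreserving.ae_eq_comp
    (UnitAddTorus.coeFn_mFourierLp 2 k)).trans ?_
  exact Filter.Eventually.of_forall fun x => mFourier_toTorus k x

/-! ### Fourier coefficients of real functions -/

/-- The complexification `L²(Y) → L²(Y;ℂ)`. -/
def complexify (n : ℕ) : L2per n →L[ℝ] Lp ℂ 2 (cellMeasure n) :=
  Complex.ofRealCLM.compLpL 2 (cellMeasure n)

theorem coeFn_complexify {n : ℕ} (u : L2per n) :
    complexify n u =ᵐ[cellMeasure n] fun x => (u x : ℂ) :=
  ContinuousLinearMap.coeFn_compLpL _ u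

/-- The Fourier coefficient of a real function on the unit cell. -/
def coeff {n : ℕ} (u : L2per n) (k : Fin n → ℤ) : ℂ :=
  inner ℂ (cellBasis n k) (complexify n u)

theorem coeff_eq_integral {n : ℕ} (u : L2per n) (k : Fin n → ℤ) :
    coeff u k = ∫ x in unitCell n, (u x : ℂ) * conj (character k x) := by
  rw [coeff, L2.inner_def]
  refine integral_congr_ae ?_
  filter_upwards [coeFn_cellBasis k, coeFn_complexify u] with x h1 h2
  rw [h1, h2, RCLike.inner_apply]

theorem continuous_coeff {n : ℕ} (k : Fin n → ℤ) : Continuous fun u : L2per n => coeff u k :=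
  continuous_const.inner (complexify n).continuous

theorem coeff_sub {n : ℕ} (u v : L2per n) (k : Fin n → ℤ) :
    coeff (u - v) k = coeff u k - coeff v k := by
  rw [coeff, map_sub, inner_sub_right]; rfl

theorem coeff_sum {n : ℕ} {ι : Type*} (s : Finset ι) (u : ι → L2per n) (k : Fin n → ℤ) :
    coeff (∑ i ∈ s, u i) k = ∑ i ∈ s, coeff (u i) k := by
  rw [coeff, map_sum, inner_sum]; rfl

theorem character_zero {n : ℕ} (x : Fin n → ℝ) : character 0 x = 1 := by simp [character]

theorem coeff_zero_eq_integral {n : ℕ} (u : L2per n) :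
    coeff u 0 = ((∫ x in unitCell n, u x : ℝ) : ℂ) := by
  rw [coeff_eq_integral, ← integral_complex_ofReal]
  simp [character_zero]

/-- Parseval's identity. -/
theorem hasSum_coeff_mul {n : ℕ} (u v : L2per n) :
    HasSum (fun k => conj (coeff u k) * coeff v k) ((inner ℝ u v : ℝ) : ℂ) := by
  have h := (cellBasis n).hasSum_inner_mul_inner (complexify n u) (complexify n v)
  have h2 : inner ℂ (complexify n u) (complexify n v) = ((inner ℝ u v : ℝ) : ℂ) := by
    rw [L2.inner_def, L2.inner_def, ← integral_complex_ofReal]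
    refine integral_congr_ae ?_
    filter_upwards [coeFn_complexify u, coeFn_complexify v] with x h1 h2
    rw [h1, h2]
    simp [RCLike.inner_apply]
  rw [h2] at h
  simpa only [coeff, inner_conj_symm] using h

theorem hasSum_norm_coeff_sq {n : ℕ} (u : L2per n) :
    HasSum (fun k => ‖coeff u k‖ ^ 2) (‖u‖ ^ 2) := by
  have h := hasSum_coeff_mul u u
  rw [real_inner_self_eq_norm_sq] at h
  refine Complex.hasSum_ofReal.1 ?_
  refine h.congr_fun fun k => ?_
  rw [mul_comm, Complex.mul_conj, Complex.normSq_eq_norm_sq]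

theorem ext_coeff {n : ℕ} {u v : L2per n} (h : ∀ k, coeff u k = coeff v k) : u = v := by
  have h1 := hasSum_norm_coeff_sq (u - v)
  have h2 : (fun k => ‖coeff (u - v) k‖ ^ 2) = fun _ => 0 := by
    funext k
    rw [coeff_sub, h k, sub_self, norm_zero, zero_pow two_ne_zero]
  rw [h2] at h1
  have h3 := h1.unique hasSum_zero
  exact sub_eq_zero.1 (norm_eq_zero.1 (pow_eq_zero_iff two_ne_zero |>.1 h3))

theorem character_neg {n : ℕ} (k : Fin n → ℤ) (x : Fin n → ℝ) :
    character (-k) x = conj (character k x) := by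
  rw [← mFourier_toTorus, UnitAddTorus.mFourier_neg, mFourier_toTorus]

theorem coeff_neg_index {n : ℕ} (u : L2per n) (k : Fin n → ℤ) :
    coeff u (-k) = conj (coeff u k) := by
  rw [coeff_eq_integral, coeff_eq_integral, ← integral_conj]
  simp [character_neg]

/-- A Hermitian square summable family is the family of Fourier coefficients of a real function. -/
theorem exists_coeff_eq {n : ℕ} (a : (Fin n → ℤ) → ℂ) (ha : Summable fun k => ‖a k‖ ^ 2)
    (hconj : ∀ k, a (-k) = conj (a k)) : ∃ u : L2per n, ∀ k, coeff u k = a k := by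
  have hmem : Memℓp a 2 := memℓp_gen (by simpa using ha)
  set f : Lp ℂ 2 (cellMeasure n) := (cellBasis n).repr.symm ⟨a, hmem⟩ with hf
  have hfa : ∀ k, ∫ x in unitCell n, f x * conj (character k x) = a k := by
    intro k
    have h1 : (cellBasis n).repr f k = a k := by rw [hf]; simp
    rw [← h1, HilbertBasis.repr_apply_apply, L2.inner_def]
    refine integral_congr_ae ?_
    filter_upwards [coeFn_cellBasis k] with x hx
    rw [hx, RCLike.inner_apply]
  -- By Hermitian symmetry `conj f` has the same coefficients as `f`. Hence so does the average of
  -- the two, the real part of `f`, which is the witness below.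
  have hfa' : ∀ k, ∫ x in unitCell n, conj (f x) * conj (character k x) = a k := by
    intro k
    have h := congrArg conj (hfa (-k))
    rw [← integral_conj, hconj, Complex.conj_conj] at h
    rw [← h]
    simp [character_neg]
  refine ⟨Complex.reCLM.compLp f, fun k => ?_⟩
  have hint : ∀ g : (Fin n → ℝ) → ℂ, Integrable g (cellMeasure n) →
      Integrable (fun x => g x * conj (character k x)) (cellMeasure n) := by
    intro g hg
    refine hg.mul_bdd (c := 1) ?_ (Filter.Eventually.of_forall fun x => ?_)
    · refine Continuous.aestronglyMeasurable ?_
      unfold character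
      fun_prop
    · rw [RCLike.norm_conj, ← mFourier_toTorus]
      exact (ContinuousMap.norm_coe_le_norm _ _).trans UnitAddTorus.mFourier_norm.le
  have hfi : Integrable f (cellMeasure n) := (Lp.memLp f).integrable (by norm_num)
  have hfi' : Integrable (fun x => conj (f x)) (cellMeasure n) :=
    (Complex.conjCLE.toContinuousLinearMap.integrable_comp hfi)
  have key : coeff (Complex.reCLM.compLp f) k =
      (1 / 2) * ∫ x in unitCell n, (f x * conj (character k x) +
        conj (f x) * conj (character k x)) := by
    rw [coeff_eq_integral, ← integral_const_mul]
    refine integral_congr_ae ?_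
    filter_upwards [ContinuousLinearMap.coeFn_compLp Complex.reCLM f] with x hx
    rw [hx, Complex.reCLM_apply, Complex.re_eq_add_conj]
    ring
  rw [key, integral_add (hint _ hfi) (hint _ hfi'), hfa, hfa']
  ring

/-! ### Weak derivatives on the Fourier side -/

/-- The integral over the unit cell of a partial derivative of a periodic function vanishes. -/
theorem integral_fderiv_periodic {n : ℕ} {F : (Fin n → ℝ) → ℂ} (hF : ContDiff ℝ 1 F) (i : Fin n)
    (hper : ∀ x, F (x + Pi.single i 1) = F x) :
    ∫ x in unitCell n, fderiv ℝ F x (Pi.single i 1) = 0 := by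
  obtain _ | m := n
  · exact i.elim0
  rw [setIntegral_congr_set (unitCell_ae_eq_Icc (m + 1))]
  have hcont : Continuous fun x => fderiv ℝ F x (Pi.single i 1) :=
    (hF.continuous_fderiv one_ne_zero).clm_apply continuous_const
  have hsum : ∀ x : Fin (m + 1) → ℝ,
      (∑ j, ((ContinuousLinearMap.single ℝ (fun _ : Fin (m + 1) => ℂ) i).comp (fderiv ℝ F x))
        (Pi.single j 1) j) = fderiv ℝ F x (Pi.single i 1) := by
    intro x
    rw [Finset.sum_eq_single i]
    · simp
    · intro j _ hj
      simp [Pi.single_eq_of_ne hj]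
    · simp
  -- Divergence theorem for the field `F e_i`, whose divergence is `∂_i F`.
  have h := integral_divergence_of_hasFDerivAt_off_countable (0 : Fin (m + 1) → ℝ) 1
    (fun _ => zero_le_one)
    (fun x => ContinuousLinearMap.single ℝ (fun _ : Fin (m + 1) => ℂ) i (F x))
    (fun x => (ContinuousLinearMap.single ℝ (fun _ : Fin (m + 1) => ℂ) i).comp (fderiv ℝ F x))
    ∅ Set.countable_empty
    ((ContinuousLinearMap.continuous _).comp hF.continuous).continuousOn
    (fun x _ => (ContinuousLinearMap.hasFDerivAt _).comp x
      (hF.differentiable one_ne_zero x).hasFDerivAt)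
    (by
      simp only [hsum]
      exact hcont.continuousOn.integrableOn_compact isCompact_Icc)
  simp only [hsum] at h
  rw [h]
  -- The two faces normal to `e_i` are translates of each other by `e_i` and cancel by periodicity.
  -- On the other faces the normal component of `F e_i` is zero.
  refine Finset.sum_eq_zero fun j _ => ?_
  by_cases hj : j = i
  · subst hj
    rw [sub_eq_zero]
    refine integral_congr_ae (Filter.Eventually.of_forall fun x => ?_)
    have hx : j.insertNth ((1 : Fin (m + 1) → ℝ) j) x =
        (j.insertNth ((0 : Fin (m + 1) → ℝ) j) x : Fin (m + 1) → ℝ) + Pi.single j 1 := by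
      funext l
      refine Fin.succAboveCases j ?_ (fun l => ?_) l
      · simp
      · simp [Fin.succAbove_ne]
    simp only [ContinuousLinearMap.single_apply, Pi.single_eq_same]
    rw [hx, hper]
  · simp [Pi.single_eq_of_ne hj]

theorem hasFDerivAt_character {n : ℕ} (k : Fin n → ℤ) (x : Fin n → ℝ) :
    HasFDerivAt (character k) (character k x • (2 * Real.pi * Complex.I : ℂ) •
      Complex.ofRealCLM.comp
        (∑ j, (k j : ℝ) • ContinuousLinearMap.proj (R := ℝ) (φ := fun _ : Fin n => ℝ) j)) x := by
  have h1 : HasFDerivAt (fun x : Fin n → ℝ => ∑ j, (k j : ℝ) * x j)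
      (∑ j, (k j : ℝ) • ContinuousLinearMap.proj (R := ℝ) (φ := fun _ : Fin n => ℝ) j) x := by
    convert! (∑ j, (k j : ℝ) • ContinuousLinearMap.proj (R := ℝ)
      (φ := fun _ : Fin n => ℝ) j).hasFDerivAt (x := x) using 1
    funext y
    simp
  exact ((Complex.ofRealCLM.hasFDerivAt.comp x h1).const_mul (2 * Real.pi * Complex.I : ℂ)).cexp

theorem fderiv_character {n : ℕ} (k : Fin n → ℤ) (x : Fin n → ℝ) (i : Fin n) :
    fderiv ℝ (character k) x (Pi.single i 1) = 2 * Real.pi * Complex.I * k i * character k x := by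
  rw [(hasFDerivAt_character k x).fderiv]
  have h : (∑ j, (k j : ℝ) • ContinuousLinearMap.proj (R := ℝ) (φ := fun _ : Fin n => ℝ) j)
      (Pi.single i 1) = k i := by
    simp [Pi.single_apply]
  simp only [smul_apply, ContinuousLinearMap.comp_apply, h, smul_eq_mul,
    Complex.ofRealCLM_apply]
  push_cast
  ring

theorem contDiff_character {n : ℕ} (k : Fin n → ℤ) {m : WithTop ℕ∞} :
    ContDiff ℝ m (character k) := by
  unfold character
  have h : ContDiff ℝ m fun x : Fin n → ℝ => ∑ j, (k j : ℝ) * x j := by fun_prop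
  exact ContDiff.cexp (contDiff_const.mul (Complex.ofRealCLM.contDiff.comp h))

theorem character_add_single {n : ℕ} (k : Fin n → ℤ) (i : Fin n) (x : Fin n → ℝ) :
    character k (x + Pi.single i 1) = character k x := by
  rw [← mFourier_toTorus, ← mFourier_toTorus]
  congr 1
  funext j
  by_cases hj : j = i
  · subst hj
    simp [toTorus]
  · simp [toTorus, Pi.single_eq_of_ne hj]

theorem integrable_ofReal_mul {n : ℕ} (u : L2per n) {c : (Fin n → ℝ) → ℂ} (hc : Continuous c) :
    Integrable (fun x => (u x : ℂ) * c x) (cellMeasure n) := by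
  have hre := integrable_mul_continuous u (Complex.continuous_re.comp hc)
  have him := integrable_mul_continuous u (Complex.continuous_im.comp hc)
  refine (hre.ofReal.add (him.ofReal.mul_const Complex.I)).congr
    (Filter.Eventually.of_forall fun x => ?_)
  apply Complex.ext <;> simp

/-- Weak derivatives may be tested against complex valued functions. -/
theorem IsWeakPartial.integral_complex {n : ℕ} {i : Fin n} {u g : L2per n}
    (h : IsWeakPartial i u g) {c : (Fin n → ℝ) → ℂ} (hc : ContDiff ℝ ∞ c)
    (hper : ∀ (j : Fin n) (x : Fin n → ℝ), c (x + Pi.single j 1) = c x) :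
    ∫ x in unitCell n, (u x : ℂ) * fderiv ℝ c x (Pi.single i 1) =
      - ∫ x in unitCell n, (g x : ℂ) * c x := by
  have hd : ∀ x, HasFDerivAt c (fderiv ℝ c x) x := fun x =>
    (hc.differentiable (by simp) x).hasFDerivAt
  have hcd : Continuous fun x => fderiv ℝ c x (Pi.single i 1) :=
    (hc.continuous_fderiv (by simp)).clm_apply continuous_const
  -- `L` stands for the real or the imaginary part, so that `L ∘ c` is an admissible real test
  -- function.
  have test : ∀ L : ℂ →L[ℝ] ℝ, (∀ (a : ℝ) (z : ℂ), L (a * z) = a * L z) →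
      L (∫ x in unitCell n, (u x : ℂ) * fderiv ℝ c x (Pi.single i 1)) =
        L (- ∫ x in unitCell n, (g x : ℂ) * c x) := by
    intro L hL
    rw [map_neg, ← L.integral_comp_comm (integrable_ofReal_mul u hcd),
      ← L.integral_comp_comm (integrable_ofReal_mul g hc.continuous)]
    have hφ : IsSmoothPeriodic fun x => L (c x) :=
      ⟨L.contDiff.comp hc, fun j x => by rw [hper]⟩
    have h' := h _ hφ
    simp only [hL]
    rw [← h']
    refine integral_congr_ae (Filter.Eventually.of_forall fun x => ?_)
    have : fderiv ℝ (fun x => L (c x)) x = L.comp (fderiv ℝ c x) :=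
      (L.hasFDerivAt.comp x (hd x)).fderiv
    simp only [partialDeriv, this, ContinuousLinearMap.comp_apply]
  apply Complex.ext
  · exact test Complex.reCLM (by simp)
  · exact test Complex.imCLM (by simp)

/-- The test function is `character (-k)`, the conjugate character, for which `∂_i` acts as
multiplication by `-2πi k_i`. -/
theorem IsWeakPartial.coeff_eq {n : ℕ} {i : Fin n} {u g : L2per n} (h : IsWeakPartial i u g)
    (k : Fin n → ℤ) : coeff g k = 2 * Real.pi * Complex.I * k i * coeff u k := by
  have h1 := h.integral_complex (contDiff_character (-k)) (character_add_single (-k))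
  simp only [fderiv_character] at h1
  rw [coeff_eq_integral, coeff_eq_integral, ← integral_const_mul]
  simp only [character_neg] at h1
  rw [← neg_eq_iff_eq_neg] at h1
  rw [← h1, ← integral_neg]
  refine integral_congr_ae (Filter.Eventually.of_forall fun x => ?_)
  simp only [Pi.neg_apply, Int.cast_neg]
  ring

theorem memLp_of_continuous {n : ℕ} {φ : (Fin n → ℝ) → ℝ} (hφ : Continuous φ) :
    MemLp φ 2 (cellMeasure n) := by
  rw [cellMeasure, Measure.restrict_congr_set (unitCell_ae_eq_Icc n)]
  obtain ⟨C, hC⟩ := (isCompact_Icc (a := (0 : Fin n → ℝ)) (b := 1)).exists_bound_of_continuousOn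
    hφ.continuousOn
  have : IsFiniteMeasure ((volume : Measure (Fin n → ℝ)).restrict (Set.Icc 0 1)) :=
    ⟨by rw [Measure.restrict_apply_univ]; exact isCompact_Icc.measure_lt_top⟩
  exact MemLp.of_bound hφ.aestronglyMeasurable C
    ((ae_restrict_iff' measurableSet_Icc).2 (Filter.Eventually.of_forall hC))

theorem coeff_toLp {n : ℕ} {φ : (Fin n → ℝ) → ℝ} (hφ : MemLp φ 2 (cellMeasure n))
    (k : Fin n → ℤ) :
    coeff (hφ.toLp φ) k = ∫ x in unitCell n, (φ x : ℂ) * conj (character k x) := by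
  rw [coeff_eq_integral]
  refine integral_congr_ae ?_
  filter_upwards [hφ.coeFn_toLp] with x hx
  rw [hx]

theorem inner_toLp {n : ℕ} (u : L2per n) {φ : (Fin n → ℝ) → ℝ} (hφ : MemLp φ 2 (cellMeasure n)) :
    inner ℝ u (hφ.toLp φ) = ∫ x in unitCell n, u x * φ x := by
  rw [L2.inner_def]
  refine integral_congr_ae ?_
  filter_upwards [hφ.coeFn_toLp] with x hx
  simp [hx, mul_comm]

/-- Integration by parts: `∂_i (φ · character (-k))` has zero integral over a period. -/
theorem IsSmoothPeriodic.integral_partialDeriv_mul_character {n : ℕ} {φ : (Fin n → ℝ) → ℝ}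
    (hφ : IsSmoothPeriodic φ) (i : Fin n) (k : Fin n → ℤ) :
    ∫ x in unitCell n, (partialDeriv i φ x : ℂ) * conj (character k x) =
      2 * Real.pi * Complex.I * k i * ∫ x in unitCell n, (φ x : ℂ) * conj (character k x) := by
  have hφC : ContDiff ℝ 1 fun x => (φ x : ℂ) :=
    Complex.ofRealCLM.contDiff.comp (hφ.smooth.of_le (by norm_cast))
  have h := integral_fderiv_periodic (F := (fun x => (φ x : ℂ)) * character (-k))
    (hφC.mul (contDiff_character (-k))) i
    (fun x => by simp only [Pi.mul_apply, hφ.periodic, character_add_single])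
  have hd : ∀ x, fderiv ℝ ((fun x => (φ x : ℂ)) * character (-k)) x (Pi.single i 1) =
      (partialDeriv i φ x : ℂ) * conj (character k x) -
        2 * Real.pi * Complex.I * k i * ((φ x : ℂ) * conj (character k x)) := by
    intro x
    have h1 : HasFDerivAt (fun x => (φ x : ℂ)) (Complex.ofRealCLM.comp (fderiv ℝ φ x)) x :=
      Complex.ofRealCLM.hasFDerivAt.comp x (hφ.smooth.differentiable (by simp) x).hasFDerivAt
    have h2 : HasFDerivAt (character (-k)) (fderiv ℝ (character (-k)) x) x :=
      (hasFDerivAt_character (-k) x).differentiableAt.hasFDerivAt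
    rw [(h1.mul h2).fderiv]
    simp only [add_apply, smul_apply, smul_eq_mul,
      ContinuousLinearMap.comp_apply, fderiv_character, Complex.ofRealCLM_apply, partialDeriv,
      character_neg, Pi.neg_apply, Int.cast_neg]
    ring
  simp only [hd] at h
  have hc : Continuous fun x => conj (character k x) :=
    Complex.continuous_conj.comp (contDiff_character k (m := 0)).continuous
  have hi : ∀ ψ : (Fin n → ℝ) → ℝ, Continuous ψ →
      Integrable (fun x => (ψ x : ℂ) * conj (character k x)) (cellMeasure n) := by
    intro ψ hψ
    rw [cellMeasure, Measure.restrict_congr_set (unitCell_ae_eq_Icc n)]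
    exact ((Complex.continuous_ofReal.comp hψ).mul hc).continuousOn.integrableOn_compact
      isCompact_Icc
  rw [integral_sub (hi _ (hφ.continuous_partialDeriv i))
    ((hi _ hφ.smooth.continuous).const_mul _), integral_const_mul, sub_eq_zero] at h
  exact h

/-- Weak partial derivatives are characterized by their Fourier coefficients. -/
theorem isWeakPartial_iff_coeff {n : ℕ} {i : Fin n} {u g : L2per n} :
    IsWeakPartial i u g ↔ ∀ k, coeff g k = 2 * Real.pi * Complex.I * k i * coeff u k := by
  refine ⟨fun h k => h.coeff_eq k, fun h φ hφ => ?_⟩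
  have m0 := memLp_of_continuous hφ.smooth.continuous
  have m1 := memLp_of_continuous (hφ.continuous_partialDeriv i)
  rw [← inner_toLp u m1, ← inner_toLp g m0]
  -- By Parseval both sides of the weak identity are Fourier series. They agree term by term because
  -- `2πi k_i` is purely imaginary, so conjugation yields the minus sign.
  have s1 := hasSum_coeff_mul u (m1.toLp _)
  have s2 := (hasSum_coeff_mul g (m0.toLp _)).neg
  apply Complex.ofReal_injective
  rw [Complex.ofReal_neg]
  refine s1.unique (s2.congr_fun fun k => ?_)
  rw [coeff_toLp, coeff_toLp, hφ.integral_partialDeriv_mul_character, h k]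
  simp only [map_mul, Complex.conj_I, Complex.conj_ofReal, map_ofNat, map_intCast]
  ring

/-! ### Identities and Poincaré's inequality in `H¹_{per,0}`; completeness -/

theorem isWeakPartial_grad {n : ℕ} (v : H1perZero n) (i j : Fin n) :
    IsWeakPartial j (comp v i) (grad v i j) := v.2.1 i j

theorem integral_comp_eq_zero {n : ℕ} (v : H1perZero n) (i : Fin n) :
    ∫ x in unitCell n, comp v i x = 0 := v.2.2 i

theorem coeff_grad {n : ℕ} (v : H1perZero n) (i j : Fin n) (k : Fin n → ℤ) :
    coeff (grad v i j) k = 2 * Real.pi * Complex.I * k j * coeff (comp v i) k :=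
  (isWeakPartial_grad v i j).coeff_eq k

/-- The element of `H¹_{per,0}` with given components and weak gradient. -/
def mkH1perZero {n : ℕ} (p : Fin n → L2per n) (H : Fin n → Fin n → L2per n)
    (h : ∀ i j, IsWeakPartial j (p i) (H i j)) (h0 : ∀ i, ∫ x in unitCell n, p i x = 0) :
    H1perZero n :=
  ⟨WithLp.toLp 2 (WithLp.toLp 2 p, WithLp.toLp 2 fun ij => H ij.1 ij.2), h, h0⟩

@[simp]
theorem grad_mkH1perZero {n : ℕ} (p : Fin n → L2per n) (H : Fin n → Fin n → L2per n)
    (h : ∀ i j, IsWeakPartial j (p i) (H i j)) (h0 : ∀ i, ∫ x in unitCell n, p i x = 0) :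
    grad (mkH1perZero p H h h0) = H := rfl

theorem norm_sq_H1perZero {n : ℕ} (v : H1perZero n) :
    ‖v‖ ^ 2 = ∑ i, ‖comp v i‖ ^ 2 + ∑ i, ∑ j, ‖grad v i j‖ ^ 2 := by
  rw [Submodule.coe_norm, WithLp.prod_norm_sq_eq_of_L2, PiLp.norm_sq_eq_of_L2,
    PiLp.norm_sq_eq_of_L2, Fintype.sum_prod_type]
  rfl

/-- Weak derivatives have zero mean. -/
theorem IsWeakPartial.integral_eq_zero {n : ℕ} {i : Fin n} {u g : L2per n}
    (h : IsWeakPartial i u g) : ∫ x in unitCell n, g x = 0 := by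
  have h1 := h.coeff_eq 0
  rw [coeff_zero_eq_integral] at h1
  simpa using h1

/-- The components of the gradient of a weak gradient are symmetric. -/
theorem grad_symm_of_isWeakPartial {n : ℕ} {φ : L2per n} {v : H1perZero n}
    (h : ∀ i, IsWeakPartial i φ (comp v i)) (i j : Fin n) : grad v i j = grad v j i := by
  refine ext_coeff fun k => ?_
  rw [coeff_grad, coeff_grad, (h i).coeff_eq, (h j).coeff_eq]
  ring

/-- Integrating by parts twice exchanges the two derivatives. On the Fourier side both products have
the terms `4π² k_i k_j conj(v̂_i) v̂_j`. -/
theorem inner_grad_swap {n : ℕ} (v : H1perZero n) (i j : Fin n) :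
    inner ℝ (grad v i j) (grad v j i) = inner ℝ (grad v i i) (grad v j j) := by
  apply Complex.ofReal_injective
  refine (hasSum_coeff_mul _ _).unique ((hasSum_coeff_mul _ _).congr_fun fun k => ?_)
  simp only [coeff_grad, map_mul, map_intCast]
  ring

/-- `‖Dv - (Dv)ᵀ‖² / 2 = ‖Dv‖² - ‖∇·v‖²`. -/
theorem half_norm_sq_skew {n : ℕ} (v : H1perZero n) :
    (1 / 2) * ∑ i, ∑ j, ‖grad v i j - grad v j i‖ ^ 2 =
      (∑ i, ∑ j, ‖grad v i j‖ ^ 2) - ‖∑ i, grad v i i‖ ^ 2 := by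
  have h1 : ‖∑ i, grad v i i‖ ^ 2 = ∑ i, ∑ j, inner ℝ (grad v i j) (grad v j i) := by
    rw [← real_inner_self_eq_norm_sq, sum_inner]
    refine Finset.sum_congr rfl fun i _ => ?_
    rw [inner_sum]
    exact Finset.sum_congr rfl fun j _ => (inner_grad_swap v i j).symm
  have h2 : ∑ i, ∑ j, ‖grad v j i‖ ^ 2 = ∑ i, ∑ j, ‖grad v i j‖ ^ 2 := Finset.sum_comm
  simp only [norm_sub_sq_real, Finset.sum_add_distrib, Finset.sum_sub_distrib,
    ← Finset.mul_sum, h2, ← h1]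
  ring

/-- The spectral gap behind Poincaré's inequality and the boundedness of the Poisson multipliers. -/
theorem one_le_sum_sq {n : ℕ} {k : Fin n → ℤ} (hk : k ≠ 0) : (1 : ℝ) ≤ ∑ j, (k j : ℝ) ^ 2 := by
  obtain ⟨j, hj⟩ := Function.ne_iff.1 hk
  have hpos : 0 < k j ^ 2 := by
    have h : k j ≠ 0 := hj
    positivity
  have h1 : (1 : ℝ) ≤ (k j : ℝ) ^ 2 := by exact_mod_cast Order.one_le_iff_pos.2 hpos
  exact h1.trans (Finset.single_le_sum (f := fun j => (k j : ℝ) ^ 2)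
    (fun _ _ => sq_nonneg _) (Finset.mem_univ j))

/-- Poincaré's inequality for periodic functions of zero mean. -/
theorem poincare {n : ℕ} (v : H1perZero n) (i : Fin n) :
    4 * Real.pi ^ 2 * ‖comp v i‖ ^ 2 ≤ ∑ j, ‖grad v i j‖ ^ 2 := by
  have h1 := (hasSum_norm_coeff_sq (comp v i)).mul_left (4 * Real.pi ^ 2)
  have h2 := hasSum_sum fun (j : Fin n) (_ : j ∈ Finset.univ) =>
    hasSum_norm_coeff_sq (grad v i j)
  refine hasSum_le (fun k => ?_) h1 h2
  have hs : ∑ j, ‖coeff (grad v i j) k‖ ^ 2 =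
      4 * Real.pi ^ 2 * ‖coeff (comp v i) k‖ ^ 2 * ∑ j, (k j : ℝ) ^ 2 := by
    rw [Finset.mul_sum]
    refine Finset.sum_congr rfl fun j _ => ?_
    rw [coeff_grad]
    simp only [norm_mul, Complex.norm_I, Complex.norm_real, Complex.norm_intCast,
      Complex.norm_ofNat, Real.norm_eq_abs, mul_pow, sq_abs, one_pow]
    ring
  rw [hs]
  -- The zero frequency is where the zero mean enters: `|k|² = 0` there, but the coefficient
  -- vanishes too.
  by_cases hk : k = 0
  · subst hk
    rw [coeff_zero_eq_integral, integral_comp_eq_zero]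
    simp
  · exact le_mul_of_one_le_right (by positivity) (one_le_sum_sq hk)

/-- In Fourier terms the constraints are equalities between continuous functions of the pair `(v,
Dv)`, so they cut out a closed subspace of a Hilbert space. -/
instance completeSpace_H1perZero (n : ℕ) : CompleteSpace (H1perZero n) := by
  have hset : ((H1perZero n : Submodule ℝ (FieldWithGrad n)) : Set (FieldWithGrad n)) =
      (⋂ (i : Fin n) (j : Fin n) (k : Fin n → ℤ), {u | coeff (u.snd (i, j)) k =
        2 * Real.pi * Complex.I * k j * coeff (u.fst i) k}) ∩
      ⋂ i : Fin n, {u | coeff (u.fst i) 0 = 0} := by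
    ext u
    simp only [Set.mem_inter_iff, Set.mem_iInter, Set.mem_ofPred_eq, coeff_zero_eq_integral,
      Complex.ofReal_eq_zero, ← isWeakPartial_iff_coeff]
    rfl
  have h1 : ∀ (i : Fin n) (k : Fin n → ℤ),
      Continuous fun u : FieldWithGrad n => coeff (u.fst i) k := fun i k =>
    (continuous_coeff k).comp (by fun_prop)
  have h2 : ∀ (ij : Fin n × Fin n) (k : Fin n → ℤ),
      Continuous fun u : FieldWithGrad n => coeff (u.snd ij) k := fun i k =>
    (continuous_coeff k).comp (by fun_prop)
  have hclosed : IsClosed ((H1perZero n : Submodule ℝ (FieldWithGrad n)) :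
      Set (FieldWithGrad n)) := by
    rw [hset]
    refine IsClosed.inter ?_ (isClosed_iInter fun i => isClosed_eq (h1 i 0) continuous_const)
    exact isClosed_iInter fun i => isClosed_iInter fun j => isClosed_iInter fun k =>
      isClosed_eq (h2 (i, j) k) (continuous_const.mul (h1 i k))
  exact hclosed.completeSpace_coe

/-! ### The periodic Poisson problem -/

/-- A real bounded Fourier multiplier. -/
theorem exists_multiplier {n : ℕ} (m : (Fin n → ℤ) → ℂ) {C : ℝ} (hC : ∀ k, ‖m k‖ ≤ C)
    (hm : ∀ k, m (-k) = conj (m k)) (q : L2per n) :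
    ∃ u : L2per n, ∀ k, coeff u k = m k * coeff q k := by
  refine exists_coeff_eq _ ?_ fun k => by rw [hm, coeff_neg_index, map_mul]
  refine Summable.of_nonneg_of_le (fun k => by positivity) (fun k => ?_)
    ((hasSum_norm_coeff_sq q).summable.mul_left (C ^ 2))
  rw [norm_mul, mul_pow]
  gcongr
  exact hC k

/-- Solvability of the periodic Poisson problem in `H²`. -/
theorem exists_poisson {n : ℕ} (q : L2per n) (hq : ∫ x in unitCell n, q x = 0) :
    ∃ (φ : L2per n) (v : H1perZero n), (∀ i, IsWeakPartial i φ (comp v i)) ∧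
      ∑ i, grad v i i = q := by
  set s : (Fin n → ℤ) → ℝ := fun k => ∑ j, (k j : ℝ) ^ 2 with hs
  have hs1 : ∀ k, k ≠ 0 → 1 ≤ s k := fun k => one_le_sum_sq
  have hsneg : ∀ k, s (-k) = s k := fun k => by simp [hs]
  have hs0 : s 0 = 0 := by simp [hs]
  have hsnn : ∀ k, 0 ≤ s k := fun k => Finset.sum_nonneg fun j _ => sq_nonneg _
  have hkj : ∀ k j, |(k j : ℝ)| ^ 2 ≤ s k := fun k j => by
    rw [sq_abs]
    exact Finset.single_le_sum (f := fun j => (k j : ℝ) ^ 2)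
        (fun _ _ => sq_nonneg _) (Finset.mem_univ j)
  have hdiv : ∀ (k : Fin n → ℤ) (t : ℝ), 0 ≤ t → t ≤ s k → t * (s k)⁻¹ ≤ 1 := by
    intro k t ht hts
    exact mul_inv_le_one_of_le₀ hts (hsnn k)
  have hinv : ∀ k, (s k)⁻¹ ≤ 1 := by
    intro k
    by_cases hk : k = 0
    · rw [hk, hs0, inv_zero]; exact zero_le_one
    · exact inv_le_one_of_one_le₀ (hs1 k hk)
  have habs : ∀ k j, |(k j : ℝ)| ≤ s k := by
    intro k j
    by_cases hk : k = 0
    · rw [hk, hs0]; simp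
    · nlinarith [hkj k j, hs1 k hk, abs_nonneg (k j : ℝ)]
  set c : ℂ := 2 * Real.pi * Complex.I with hc
  have hc0 : c ≠ 0 := by simp [hc, Real.pi_ne_zero]
  have hcc : conj c = -c := by
    simp only [hc, map_mul, map_ofNat, Complex.conj_ofReal, Complex.conj_I]
    ring
  -- With `c = 2πi` the Laplacian has symbol `c² |k|²`. Inverting it gives `φ`; multiplying by `c
  -- k_i`, then by `c k_j`, gives the multipliers of `∇φ` and `D²φ`. At `k = 0` the convention `0⁻¹
  -- = 0` makes them all vanish.
  obtain ⟨φ, hφ⟩ := exists_multiplier (fun k => c⁻¹ ^ 2 * ((s k)⁻¹ : ℝ)) (C := ‖c⁻¹ ^ 2‖)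
    (fun k => by
      rw [norm_mul, Complex.norm_real, Real.norm_of_nonneg (inv_nonneg.2 (hsnn k))]
      exact mul_le_of_le_one_right (norm_nonneg _) (hinv k))
    (fun k => by simp only [hsneg, map_mul, map_pow, map_inv₀, hcc, Complex.conj_ofReal]; ring) q
  have hp : ∀ i, ∃ p : L2per n, ∀ k, coeff p k = c⁻¹ * (k i : ℝ) * ((s k)⁻¹ : ℝ) * coeff q k :=
    fun i => exists_multiplier (fun k => c⁻¹ * (k i : ℝ) * ((s k)⁻¹ : ℝ)) (C := ‖c⁻¹‖)
      (fun k => by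
        rw [mul_assoc, norm_mul, norm_mul, Complex.norm_real, Complex.norm_real,
          Real.norm_of_nonneg (inv_nonneg.2 (hsnn k))]
        exact mul_le_of_le_one_right (norm_nonneg _) (hdiv k _ (abs_nonneg _) (habs k i)))
      (fun k => by
        simp only [hsneg, map_mul, map_inv₀, hcc, Complex.conj_ofReal, Pi.neg_apply]
        push_cast
        ring) q
  have hH : ∀ i j, ∃ p : L2per n, ∀ k,
      coeff p k = (k i * k j : ℝ) * ((s k)⁻¹ : ℝ) * coeff q k :=
    fun i j => exists_multiplier (fun k => (k i * k j : ℝ) * ((s k)⁻¹ : ℝ)) (C := 1)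
      (fun k => by
        rw [norm_mul, Complex.norm_real, Complex.norm_real,
          Real.norm_of_nonneg (inv_nonneg.2 (hsnn k)), Real.norm_eq_abs, abs_mul]
        refine hdiv k _ (by positivity) ?_
        nlinarith [hkj k i, hkj k j, sq_nonneg (|(k i : ℝ)| - |(k j : ℝ)|)])
      (fun k => by
        simp only [hsneg, map_mul, Complex.conj_ofReal, Pi.neg_apply]
        push_cast
        ring) q
  choose p hp using hp
  choose H hH using hH
  have hφp : ∀ i, IsWeakPartial i φ (p i) := fun i => isWeakPartial_iff_coeff.2 fun k => by
    rw [hp, hφ, ← hc]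
    push_cast
    field_simp
  have hpH : ∀ i j, IsWeakPartial j (p i) (H i j) := fun i j => isWeakPartial_iff_coeff.2 fun k => by
    rw [hH, hp, ← hc]
    push_cast
    field_simp
  refine ⟨φ, mkH1perZero p H hpH fun i => (hφp i).integral_eq_zero, hφp, ext_coeff fun k => ?_⟩
  rw [coeff_sum]
  simp only [grad_mkH1perZero, hH]
  rw [← Finset.sum_mul, ← Finset.sum_mul]
  by_cases hk : k = 0
  · rw [hk, coeff_zero_eq_integral, hq]
    simp
  · have h1 : (∑ i, ((k i * k i : ℝ) : ℂ)) = (s k : ℂ) := by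
      rw [hs]
      push_cast
      exact Finset.sum_congr rfl fun j _ => by ring
    rw [h1, ← Complex.ofReal_mul, mul_inv_cancel₀ (by linarith [hs1 k hk] : s k ≠ 0)]
    simp

/-! ### The Cordes condition: renormalized coefficients are close to `(I, 0)` -/

/-- Measurable coefficients on the unit cell that are close to `(I, 0)`. -/
structure IsNearIdentity {n : ℕ} (A : (Fin n → ℝ) → Matrix (Fin n) (Fin n) ℝ)
    (b : (Fin n → ℝ) → Fin n → ℝ) (ε : ℝ) : Prop where
  meas_A : ∀ i j, AEStronglyMeasurable (fun x => A x i j) (cellMeasure n)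
  meas_b : ∀ i, AEStronglyMeasurable (fun x => b x i) (cellMeasure n)
  close : ∀ᵐ x ∂cellMeasure n,
    sqNorm (fun x => A x - 1) b x ≤ ε

theorem sq_entry_le_sqNorm {n : ℕ} (A : (Fin n → ℝ) → Matrix (Fin n) (Fin n) ℝ)
    (b : (Fin n → ℝ) → Fin n → ℝ) (x : Fin n → ℝ) (i j : Fin n) : A x i j ^ 2 ≤ sqNorm A b x := by
  have h1 : A x i j ^ 2 ≤ ∑ j, A x i j ^ 2 :=
    Finset.single_le_sum (f := fun j => A x i j ^ 2) (fun _ _ => sq_nonneg _) (Finset.mem_univ j)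
  have h2 : ∑ j, A x i j ^ 2 ≤ ∑ i, ∑ j, A x i j ^ 2 :=
    Finset.single_le_sum (f := fun i => ∑ j, A x i j ^ 2)
      (fun _ _ => Finset.sum_nonneg fun _ _ => sq_nonneg _) (Finset.mem_univ i)
  have h3 : 0 ≤ ∑ i, b x i ^ 2 := Finset.sum_nonneg fun _ _ => sq_nonneg _
  unfold sqNorm
  linarith

theorem sq_drift_le_sqNorm {n : ℕ} (A : (Fin n → ℝ) → Matrix (Fin n) (Fin n) ℝ)
    (b : (Fin n → ℝ) → Fin n → ℝ) (x : Fin n → ℝ) (i : Fin n) : b x i ^ 2 ≤ sqNorm A b x := by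
  have h1 : b x i ^ 2 ≤ ∑ j, b x j ^ 2 :=
    Finset.single_le_sum (f := fun j => b x j ^ 2) (fun _ _ => sq_nonneg _) (Finset.mem_univ i)
  have h3 : 0 ≤ ∑ i, ∑ j, A x i j ^ 2 :=
    Finset.sum_nonneg fun _ _ => Finset.sum_nonneg fun _ _ => sq_nonneg _
  unfold sqNorm
  linarith

theorem sqNorm_nonneg {n : ℕ} (A : (Fin n → ℝ) → Matrix (Fin n) (Fin n) ℝ)
    (b : (Fin n → ℝ) → Fin n → ℝ) (x : Fin n → ℝ) : 0 ≤ sqNorm A b x := by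
  unfold sqNorm
  positivity

theorem IsNearIdentity.bound_A {n : ℕ} {A : (Fin n → ℝ) → Matrix (Fin n) (Fin n) ℝ}
    {b : (Fin n → ℝ) → Fin n → ℝ} {ε : ℝ} (h : IsNearIdentity A b ε) (i j : Fin n) :
    ∀ᵐ x ∂cellMeasure n, |A x i j| ≤ √ε + 1 := by
  filter_upwards [h.close] with x hx
  have h1 := Real.abs_le_sqrt ((sq_entry_le_sqNorm _ b x i j).trans hx)
  have h2 : |(1 : Matrix (Fin n) (Fin n) ℝ) i j| ≤ 1 := by
    rw [Matrix.one_apply]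
    split_ifs <;> simp
  have h3 : A x i j = (A x - 1) i j + (1 : Matrix (Fin n) (Fin n) ℝ) i j := by simp
  rw [h3]
  exact (abs_add_le _ _).trans (add_le_add h1 h2)

theorem IsNearIdentity.bound_b {n : ℕ} {A : (Fin n → ℝ) → Matrix (Fin n) (Fin n) ℝ}
    {b : (Fin n → ℝ) → Fin n → ℝ} {ε : ℝ} (h : IsNearIdentity A b ε) (i : Fin n) :
    ∀ᵐ x ∂cellMeasure n, |b x i| ≤ √ε := by
  filter_upwards [h.close] with x hx
  exact Real.abs_le_sqrt ((sq_drift_le_sqNorm _ b x i).trans hx)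

/-- Expanding `|cA - I|² + |cb|²` gives `c² (|A|² + |b|²) - 2c tr(A) + n`, a quadratic in `c` whose
minimizer is `γ`. -/
theorem sqNorm_renorm_sub_one {n : ℕ} {A : (Fin n → ℝ) → Matrix (Fin n) (Fin n) ℝ}
    {b : (Fin n → ℝ) → Fin n → ℝ} {x : Fin n → ℝ} (h : sqNorm A b x ≠ 0) :
    sqNorm (fun x => renormA A b x - 1) (renormb A b) x =
      n - (A x).trace ^ 2 / sqNorm A b x := by
  have h1 : ∀ c : ℝ, ∑ i, ∑ j, (c * A x i j - (1 : Matrix (Fin n) (Fin n) ℝ) i j) ^ 2 =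
      c ^ 2 * (∑ i, ∑ j, A x i j ^ 2) - 2 * c * (A x).trace + n := by
    intro c
    have h2 : ∀ i, ∑ j, (c * A x i j - (1 : Matrix (Fin n) (Fin n) ℝ) i j) ^ 2 =
        c ^ 2 * (∑ j, A x i j ^ 2) - 2 * c * A x i i + 1 := by
      intro i
      have h3 : ∀ j, (c * A x i j - (1 : Matrix (Fin n) (Fin n) ℝ) i j) ^ 2 =
          c ^ 2 * A x i j ^ 2 + if i = j then - 2 * c * A x i j + 1 else 0 := by
        intro j
        rw [Matrix.one_apply]
        split_ifs <;> ring
      simp only [h3, Finset.sum_add_distrib, ← Finset.mul_sum, Finset.sum_ite_eq,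
        Finset.mem_univ, if_true]
      ring
    simp only [h2, Finset.sum_add_distrib, Finset.sum_sub_distrib, ← Finset.mul_sum, Matrix.trace,
      Matrix.diag]
    simp
  have h2 : ∑ i, (gam A b x * b x i) ^ 2 = gam A b x ^ 2 * ∑ i, b x i ^ 2 := by
    simp only [mul_pow, Finset.mul_sum]
  have h3 : (∑ i, ∑ j, A x i j ^ 2) + ∑ i, b x i ^ 2 = sqNorm A b x := rfl
  have h4 : sqNorm (fun x => renormA A b x - 1) (renormb A b) x =
      gam A b x ^ 2 * sqNorm A b x - 2 * gam A b x * (A x).trace + n := by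
    simp only [sqNorm, renormA, renormb, Matrix.sub_apply, Matrix.smul_apply, Pi.smul_apply,
      smul_eq_mul] at h1 h2 h3 ⊢
    rw [h1, h2]
    ring
  rw [h4, gam]
  field_simp
  ring

theorem SettingB.isNearIdentity {n : ℕ} (hn : 0 < n)
    {A : (Fin n → ℝ) → Matrix (Fin n) (Fin n) ℝ}
    {b : (Fin n → ℝ) → Fin n → ℝ} (h : SettingB A b) :
    ∃ ε, 0 ≤ ε ∧ ε < Real.pi ^ 2 / (n + Real.pi ^ 2) ∧
      IsNearIdentity (renormA A b) (renormb A b) ε := by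
  obtain ⟨δ, hδ, hδ1, hc⟩ := h.cordes
  obtain ⟨lam, Lam, hlam, -, he⟩ := h.elliptic
  have hn1 : (1 : ℝ) ≤ n := by exact_mod_cast hn
  have hpi : 0 < Real.pi ^ 2 := by positivity
  have hδ0 : 0 < δ := lt_trans (by positivity) hδ
  have hmA : ∀ i j, AEMeasurable (fun x => A x i j) (cellMeasure n) := fun i j =>
    (h.memLp_A i j).aestronglyMeasurable.aemeasurable.restrict
  have hmb : ∀ i, AEMeasurable (fun x => b x i) (cellMeasure n) := fun i =>
    (h.memLp_b i).aestronglyMeasurable.aemeasurable.restrict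
  have hγ : AEMeasurable (gam A b) (cellMeasure n) := by
    refine AEMeasurable.div ?_ ?_
    · exact Finset.aemeasurable_fun_sum _ fun i _ => hmA i i
    · exact (Finset.aemeasurable_fun_sum _ fun i _ => Finset.aemeasurable_fun_sum _ fun j _ =>
        (hmA i j).pow_const 2).add (Finset.aemeasurable_fun_sum _ fun i _ => (hmb i).pow_const 2)
  -- The Cordes condition reads `tr(A)²/(|A|² + |b|²) ≥ n - 1 + δ`, so the distance to `(I, 0)` is
  -- at most `1 - δ`. The bound `δ > n/(n + π²)` is exactly `1 - δ < π²/(n + π²)`.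
  refine ⟨1 - δ, by linarith, ?_, fun i j => (hγ.mul (hmA i j)).aestronglyMeasurable,
    fun i => (hγ.mul (hmb i)).aestronglyMeasurable, ?_⟩
  · have h1 : Real.pi ^ 2 / (n + Real.pi ^ 2) = 1 - n / (n + Real.pi ^ 2) := by
      field_simp
      ring
    linarith
  · filter_upwards [ae_restrict_of_ae hc, ae_restrict_of_ae he] with x hx hex
    -- Ellipticity tested on `e_i` makes each diagonal entry at least `lam`.
    have htr : 0 < (A x).trace := by
      refine Finset.sum_pos (fun i _ => ?_) ⟨⟨0, hn⟩, Finset.mem_univ _⟩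
      have h1 := (hex (Pi.single i 1)).1
      simp at h1
      exact hlam.trans_le h1
    have hN : sqNorm A b x ≠ 0 := by
      intro h0
      have hA : ∀ i j, A x i j = 0 := fun i j => by
        have h1 := sq_entry_le_sqNorm A b x i j
        rw [h0] at h1
        exact pow_eq_zero_iff two_ne_zero |>.1 (le_antisymm h1 (sq_nonneg _))
      simp [Matrix.trace, hA] at htr
    have hNpos : 0 < sqNorm A b x := lt_of_le_of_ne (sqNorm_nonneg A b x) hN.symm
    have hnδ : 0 < (n : ℝ) - 1 + δ := by linarith
    rw [sqNorm_renorm_sub_one hN]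
    rw [div_le_div_iff₀ (by positivity) hnδ] at hx
    have h2 : (n : ℝ) - 1 + δ ≤ (A x).trace ^ 2 / sqNorm A b x := by
      rw [le_div_iff₀ hNpos]
      linarith
    linarith

/-! ### The bilinear form in operator terms -/

/-- Multiplication by a bounded function on `L²(Y)`. -/
theorem exists_mulCLM {n : ℕ} {a : (Fin n → ℝ) → ℝ} {C : ℝ}
    (ha : AEStronglyMeasurable a (cellMeasure n)) (hC : ∀ᵐ x ∂cellMeasure n, |a x| ≤ C) :
    ∃ M : L2per n →L[ℝ] L2per n, ∀ u, M u =ᵐ[cellMeasure n] fun x => a x * u x := by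
  have hb : ∀ u : L2per n, ∀ᵐ x ∂cellMeasure n, ‖a x * u x‖ ≤ C * ‖u x‖ := fun u => by
    filter_upwards [hC] with x hx
    rw [norm_mul]
    gcongr
    exact hx
  have hmem : ∀ u : L2per n, MemLp (fun x => a x * u x) 2 (cellMeasure n) := fun u =>
    (Lp.memLp u).of_le_mul (ha.mul (Lp.memLp u).aestronglyMeasurable) (hb u)
  refine ⟨LinearMap.mkContinuous
    { toFun := fun u => (hmem u).toLp
      map_add' := fun u v => ?_
      map_smul' := fun c u => ?_ } C fun u => ?_, fun u => (hmem u).coeFn_toLp⟩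
  · refine Lp.ext ?_
    filter_upwards [(hmem (u + v)).coeFn_toLp, Lp.coeFn_add (hmem u).toLp (hmem v).toLp,
      (hmem u).coeFn_toLp, (hmem v).coeFn_toLp, Lp.coeFn_add u v] with x h1 h2 h3 h4 h5
    rw [h1, h2, Pi.add_apply, h3, h4, h5, Pi.add_apply, mul_add]
  · refine Lp.ext ?_
    filter_upwards [(hmem (c • u)).coeFn_toLp, Lp.coeFn_smul c (hmem u).toLp,
      (hmem u).coeFn_toLp, Lp.coeFn_smul c u] with x h1 h2 h3 h4
    rw [h1, RingHom.id_apply, h2, Pi.smul_apply, h3, h4, Pi.smul_apply, smul_eq_mul, smul_eq_mul]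
    ring
  · refine Lp.norm_le_mul_norm_of_ae_le_mul ?_
    filter_upwards [(hmem u).coeFn_toLp, hb u] with x h1 h2
    refine le_of_eq_of_le ?_ h2
    exact congrArg norm h1

/-- `v ↦ v_i` as a continuous linear map. -/
def compCLM {n : ℕ} (i : Fin n) : H1perZero n →L[ℝ] L2per n where
  toFun v := comp v i
  map_add' _ _ := rfl
  map_smul' _ _ := rfl
  cont := by
    unfold comp
    fun_prop

/-- `v ↦ ∂_j v_i` as a continuous linear map. -/
def gradCLM {n : ℕ} (i j : Fin n) : H1perZero n →L[ℝ] L2per n where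
  toFun v := grad v i j
  map_add' _ _ := rfl
  map_smul' _ _ := rfl
  cont := by
    unfold grad
    fun_prop

/-- The divergence as a continuous linear map. -/
def divCLM (n : ℕ) : H1perZero n →L[ℝ] L2per n := ∑ i, gradCLM i i

theorem divCLM_apply {n : ℕ} (v : H1perZero n) : divCLM n v = ∑ i, grad v i i := by
  simp only [divCLM, sum_apply]
  rfl

theorem coeFn_divCLM {n : ℕ} (v : H1perZero n) : divCLM n v =ᵐ[cellMeasure n] div v := by
  rw [divCLM_apply]
  filter_upwards [Lp.coeFn_fun_finsetSum Finset.univ fun i => grad v i i] with x hx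
  rw [hx, div]

/-- Closeness to `(I, 0)` bounds the coefficients, so `w ↦ A : Dw + b · w` is a bounded operator
into `L²`. All later arguments use the form through this `T`. -/
theorem IsNearIdentity.exists_firstOrderCLM {n : ℕ}
    {A : (Fin n → ℝ) → Matrix (Fin n) (Fin n) ℝ}
    {b : (Fin n → ℝ) → Fin n → ℝ} {ε : ℝ} (h : IsNearIdentity A b ε) :
    ∃ T : H1perZero n →L[ℝ] L2per n,
      ∀ w, T w =ᵐ[cellMeasure n] firstOrderTerm A b (grad w) (comp w) := by
  choose M hM using fun i j => exists_mulCLM (h.meas_A i j) (h.bound_A i j)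
  choose N hN using fun i => exists_mulCLM (h.meas_b i) (h.bound_b i)
  refine ⟨(∑ ij : Fin n × Fin n, (M ij.1 ij.2).comp (gradCLM ij.1 ij.2)) +
    ∑ i, (N i).comp (compCLM i), fun w => ?_⟩
  have hT : ((∑ ij : Fin n × Fin n, (M ij.1 ij.2).comp (gradCLM ij.1 ij.2)) +
      ∑ i, (N i).comp (compCLM i)) w =
      (∑ ij : Fin n × Fin n, M ij.1 ij.2 (grad w ij.1 ij.2)) + ∑ i, N i (comp w i) := by
    simp only [add_apply, sum_apply]
    rfl
  rw [hT]
  have hM' : ∀ᵐ x ∂cellMeasure n, ∀ i j, M i j (grad w i j) x = A x i j * grad w i j x :=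
    ae_all_iff.2 fun i => ae_all_iff.2 fun j => hM i j _
  have hN' : ∀ᵐ x ∂cellMeasure n, ∀ i, N i (comp w i) x = b x i * comp w i x :=
    ae_all_iff.2 fun i => hN i _
  filter_upwards [hM', hN', Lp.coeFn_add (∑ ij : Fin n × Fin n, M ij.1 ij.2 (grad w ij.1 ij.2))
      (∑ i, N i (comp w i)),
    Lp.coeFn_fun_finsetSum Finset.univ fun ij : Fin n × Fin n => M ij.1 ij.2 (grad w ij.1 ij.2),
    Lp.coeFn_fun_finsetSum Finset.univ fun i => N i (comp w i)] with x h1 h2 h3 h4 h5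
  rw [h3, Pi.add_apply, h4, h5, Fintype.sum_prod_type]
  simp only [h1, h2, firstOrderTerm]

theorem inner_eq_integral {n : ℕ} (u v : L2per n) :
    inner ℝ u v = ∫ x in unitCell n, u x * v x := by
  rw [L2.inner_def]
  simp [mul_comm]

theorem integrable_mul_L2 {n : ℕ} (u v : L2per n) :
    Integrable (fun x => u x * v x) (cellMeasure n) := by
  simpa [mul_comm] using L2.integrable_inner (𝕜 := ℝ) u v

theorem norm_sq_eq_integral {n : ℕ} (u : L2per n) : ‖u‖ ^ 2 = ∫ x in unitCell n, u x ^ 2 := by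
  rw [← real_inner_self_eq_norm_sq, inner_eq_integral]
  simp only [sq]

theorem integrable_sq_L2 {n : ℕ} (u : L2per n) :
    Integrable (fun x => u x ^ 2) (cellMeasure n) := by
  simpa only [sq] using integrable_mul_L2 u u

theorem integral_skew {n : ℕ} (v w : H1perZero n) :
    ∫ x in unitCell n, ∑ i, ∑ j, (grad v i j x - grad v j i x) * (grad w i j x - grad w j i x) =
      ∑ i, ∑ j, inner ℝ (grad v i j - grad v j i) (grad w i j - grad w j i) := by
  have h : ∀ (u : H1perZero n), ∀ᵐ x ∂cellMeasure n, ∀ i j,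
      (grad u i j - grad u j i : L2per n) x = grad u i j x - grad u j i x := fun u =>
    ae_all_iff.2 fun i => ae_all_iff.2 fun j => Lp.coeFn_sub _ _
  simp only [inner_eq_integral]
  have hi := fun i j => integrable_mul_L2 (grad v i j - grad v j i) (grad w i j - grad w j i)
  simp only [← integral_finsetSum _ fun j _ => hi _ j]
  rw [← integral_finsetSum _ fun i _ => integrable_finsetSum _ fun j _ => hi i j]
  refine integral_congr_ae ?_
  filter_upwards [h v, h w] with x h1 h2
  simp only [h1, h2]

theorem bilinForm_eq_inner {n : ℕ} {A : (Fin n → ℝ) → Matrix (Fin n) (Fin n) ℝ}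
    {b : (Fin n → ℝ) → Fin n → ℝ} {T : H1perZero n →L[ℝ] L2per n}
    (hT : ∀ w, T w =ᵐ[cellMeasure n] firstOrderTerm A b (grad w) (comp w)) (v w : H1perZero n) :
    bilinForm A b v w = inner ℝ (divCLM n v) (T w) +
      (1 / 2) * ∑ i, ∑ j, inner ℝ (grad v i j - grad v j i) (grad w i j - grad w j i) := by
  rw [bilinForm, integral_skew, inner_eq_integral]
  congr 1
  refine integral_congr_ae ?_
  filter_upwards [coeFn_divCLM v, hT w] with x h1 h2
  rw [h1, h2]

/-- The bilinear form as a bounded operator. -/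
theorem exists_bilinCLM {n : ℕ} {A : (Fin n → ℝ) → Matrix (Fin n) (Fin n) ℝ}
    {b : (Fin n → ℝ) → Fin n → ℝ} {T : H1perZero n →L[ℝ] L2per n}
    (hT : ∀ w, T w =ᵐ[cellMeasure n] firstOrderTerm A b (grad w) (comp w)) :
    ∃ B : H1perZero n →L[ℝ] H1perZero n →L[ℝ] ℝ, ∀ v w, B v w = bilinForm A b v w := by
  let J : L2per n →L[ℝ] L2per n →L[ℝ] ℝ :=
    (isBoundedBilinearMap_inner (𝕜 := ℝ) (E := L2per n)).toContinuousLinearMap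
  have hJ : ∀ u v, J u v = inner ℝ u v := fun _ _ => rfl
  refine ⟨J.bilinearComp (divCLM n) T + (1 / 2 : ℝ) • ∑ i, ∑ j,
    J.bilinearComp (gradCLM i j - gradCLM j i) (gradCLM i j - gradCLM j i), fun v w => ?_⟩
  rw [bilinForm_eq_inner hT]
  simp only [add_apply, smul_apply, sum_apply, ContinuousLinearMap.bilinearComp_apply, hJ,
    smul_eq_mul]
  rfl

/-! ### Coercivity -/

/-- A single Cauchy–Schwarz over the disjoint union of matrix and vector indices, so that `|A|² +
|b|²` is the constant. -/
theorem sq_sum_le_sqNorm_mul {n : ℕ} (A : (Fin n → ℝ) → Matrix (Fin n) (Fin n) ℝ)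
    (b : (Fin n → ℝ) → Fin n → ℝ) (x : Fin n → ℝ) (G : Fin n → Fin n → ℝ) (p : Fin n → ℝ) :
    ((∑ i, ∑ j, A x i j * G i j) + ∑ i, b x i * p i) ^ 2 ≤
      sqNorm A b x * ((∑ i, ∑ j, G i j ^ 2) + ∑ i, p i ^ 2) := by
  have h := Finset.sum_mul_sq_le_sq_mul_sq (Finset.univ : Finset ((Fin n × Fin n) ⊕ Fin n))
    (Sum.elim (fun ij => A x ij.1 ij.2) (b x)) (Sum.elim (fun ij => G ij.1 ij.2) p)
  simp only [Fintype.sum_sum_type, Fintype.sum_prod_type, Sum.elim_inl, Sum.elim_inr] at h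
  exact h

/-- Since `∇·w = I : Dw`, the difference is `(A - I) : Dw + b · w`; pointwise Cauchy–Schwarz is then
integrated. -/
theorem norm_sq_firstOrder_sub_div_le {n : ℕ} {A : (Fin n → ℝ) → Matrix (Fin n) (Fin n) ℝ}
    {b : (Fin n → ℝ) → Fin n → ℝ} {ε : ℝ} (h : IsNearIdentity A b ε)
    {T : H1perZero n →L[ℝ] L2per n}
    (hT : ∀ w, T w =ᵐ[cellMeasure n] firstOrderTerm A b (grad w) (comp w)) (w : H1perZero n) :
    ‖T w - divCLM n w‖ ^ 2 ≤ ε * ‖w‖ ^ 2 := by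
  have hig : ∀ i, Integrable (fun x => ∑ j, grad w i j x ^ 2) (cellMeasure n) := fun i =>
    integrable_finsetSum _ fun j _ => integrable_sq_L2 (grad w i j)
  have hi1 : Integrable (fun x => ∑ i, ∑ j, grad w i j x ^ 2) (cellMeasure n) :=
    integrable_finsetSum _ fun i _ => hig i
  have hi2 : Integrable (fun x => ∑ i, comp w i x ^ 2) (cellMeasure n) :=
    integrable_finsetSum _ fun i _ => integrable_sq_L2 (comp w i)
  have hnorm : ‖w‖ ^ 2 =
      ∫ x in unitCell n, ((∑ i, ∑ j, grad w i j x ^ 2) + ∑ i, comp w i x ^ 2) := by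
    rw [integral_add hi1 hi2, integral_finsetSum _ fun i _ => hig i,
      integral_finsetSum _ fun i _ => integrable_sq_L2 (comp w i), norm_sq_H1perZero, add_comm]
    simp only [integral_finsetSum _ fun j _ => integrable_sq_L2 (grad w _ j),
      norm_sq_eq_integral]
  rw [norm_sq_eq_integral, hnorm, ← integral_const_mul]
  refine integral_mono_ae (integrable_sq_L2 _) ((hi1.add hi2).const_mul ε) ?_
  filter_upwards [h.close, Lp.coeFn_sub (T w) (divCLM n w), hT w, coeFn_divCLM w]
    with x h1 h2 h3 h4
  have h5 : firstOrderTerm A b (grad w) (comp w) x - div w x =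
      (∑ i, ∑ j, (A x - 1) i j * grad w i j x) + ∑ i, b x i * comp w i x := by
    have h6 : ∀ i, ∑ j, (1 : Matrix (Fin n) (Fin n) ℝ) i j * grad w i j x = grad w i i x := by
      intro i
      simp [Matrix.one_apply]
    simp only [Matrix.sub_apply, sub_mul, Finset.sum_sub_distrib, h6, firstOrderTerm, div]
    ring
  rw [h2, Pi.sub_apply, h3, h4, h5]
  refine (sq_sum_le_sqNorm_mul (fun x => A x - 1) b x _ _).trans ?_
  gcongr

/-- Coercivity for coefficients sufficiently close to `(I, 0)`. -/
theorem IsNearIdentity.coercive {n : ℕ} (hn : 0 < n)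
    {A : (Fin n → ℝ) → Matrix (Fin n) (Fin n) ℝ}
    {b : (Fin n → ℝ) → Fin n → ℝ} {ε : ℝ} (h : IsNearIdentity A b ε) (hε : 0 ≤ ε)
    (hε' : ε < Real.pi ^ 2 / (n + Real.pi ^ 2)) :
    ∃ c : ℝ, 0 < c ∧ ∀ w : H1perZero n, c * ‖w‖ ^ 2 ≤ bilinForm A b w w := by
  obtain ⟨T, hT⟩ := h.exists_firstOrderCLM
  have hpi : 0 < Real.pi ^ 2 := by positivity
  have hn1 : (1 : ℝ) ≤ n := by exact_mod_cast hn
  -- The Poincaré constant in `‖w‖² ≤ K ‖Dw‖²`.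
  set K : ℝ := 1 + 1 / (4 * Real.pi ^ 2) with hK
  have hK0 : 0 < K := by positivity
  -- The case `n = 1` of the threshold suffices: `π²/(1 + π²) · K = (4π² + 1)/(4π² + 4)`.
  have hκ : ε * K < 1 := by
    have h1 : ε < Real.pi ^ 2 / (1 + Real.pi ^ 2) := hε'.trans_le (by gcongr)
    have h2 : Real.pi ^ 2 / (1 + Real.pi ^ 2) * K ≤ 1 := by
      have h3 : Real.pi ^ 2 / (1 + Real.pi ^ 2) * K =
          (4 * Real.pi ^ 2 + 1) / (4 * (1 + Real.pi ^ 2)) := by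
        rw [hK]
        field_simp
      rw [h3, div_le_one (by positivity)]
      linarith
    exact (mul_lt_mul_of_pos_right h1 hK0).trans_le h2
  have hsqrt : √(ε * K) < 1 := by
    rw [Real.sqrt_lt' one_pos]
    linarith
  refine ⟨(1 - √(ε * K)) / K, div_pos (by linarith) hK0, fun w => ?_⟩
  set g : ℝ := ∑ i, ∑ j, ‖grad w i j‖ ^ 2 with hg
  have hg0 : 0 ≤ g := by positivity
  have hskew := half_norm_sq_skew w
  rw [← divCLM_apply] at hskew
  have hdiv : ‖divCLM n w‖ ^ 2 ≤ g := by
    have h1 : 0 ≤ (1 / 2) * ∑ i, ∑ j, ‖grad w i j - grad w j i‖ ^ 2 := by positivity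
    linarith
  have hpoinc : 4 * Real.pi ^ 2 * ∑ i, ‖comp w i‖ ^ 2 ≤ g := by
    rw [Finset.mul_sum]
    exact Finset.sum_le_sum fun i _ => poincare w i
  have hw : ‖w‖ ^ 2 ≤ K * g := by
    rw [norm_sq_H1perZero, ← hg, hK, add_mul, one_mul, one_div_mul_eq_div]
    have h1 : ∑ i, ‖comp w i‖ ^ 2 ≤ g / (4 * Real.pi ^ 2) := by
      rw [le_div_iff₀ (by positivity)]
      linarith
    linarith
  -- The skew part contributes `‖Dw‖² - ‖∇·w‖²`; its negative term cancels against `⟨∇·w, ∇·w⟩` from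
  -- `⟨∇·w, T w⟩`.
  have hB : bilinForm A b w w = g + inner ℝ (divCLM n w) (T w - divCLM n w) := by
    rw [bilinForm_eq_inner hT, inner_sub_right, real_inner_self_eq_norm_sq]
    simp only [real_inner_self_eq_norm_sq]
    rw [hskew]
    ring
  have hE : ‖T w - divCLM n w‖ ≤ √(ε * K) * √g := by
    rw [← Real.sqrt_mul (by positivity)]
    refine Real.le_sqrt_of_sq_le ((norm_sq_firstOrder_sub_div_le h hT w).trans ?_)
    rw [mul_assoc]
    gcongr
  have hd : ‖divCLM n w‖ ≤ √g := Real.le_sqrt_of_sq_le hdiv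
  have hinner : -(√(ε * K) * g) ≤ inner ℝ (divCLM n w) (T w - divCLM n w) := by
    have h1 := neg_le_of_abs_le (abs_real_inner_le_norm (divCLM n w) (T w - divCLM n w))
    have h2 : ‖divCLM n w‖ * ‖T w - divCLM n w‖ ≤ √g * (√(ε * K) * √g) := by gcongr
    have h3 : √g * (√(ε * K) * √g) = √(ε * K) * g := by
      rw [mul_left_comm, Real.mul_self_sqrt hg0]
    linarith
  calc (1 - √(ε * K)) / K * ‖w‖ ^ 2 ≤ (1 - √(ε * K)) / K * (K * g) := by
        have : 0 ≤ (1 - √(ε * K)) / K := (div_pos (by linarith) hK0).le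
        gcongr
    _ = (1 - √(ε * K)) * g := by field_simp
    _ ≤ bilinForm A b w w := by rw [hB]; linarith

/-! ### Lax–Milgram and very weak solutions -/

/-- The constant function `1` in `L²(Y)`. -/
def oneL2 (n : ℕ) : L2per n :=
  (memLp_of_continuous (n := n) (continuous_const (y := (1 : ℝ)))).toLp

theorem coeFn_oneL2 (n : ℕ) : oneL2 n =ᵐ[cellMeasure n] fun _ => 1 :=
  MemLp.coeFn_toLp _

theorem inner_oneL2 {n : ℕ} (u : L2per n) : inner ℝ (oneL2 n) u = ∫ x in unitCell n, u x := by
  rw [real_inner_comm, oneL2, inner_toLp]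
  simp

theorem inner_oneL2_self (n : ℕ) : inner ℝ (oneL2 n) (oneL2 n) = 1 := by
  rw [inner_oneL2, integral_congr_ae (coeFn_oneL2 n)]
  simp

theorem inner_oneL2_divCLM {n : ℕ} (v : H1perZero n) : inner ℝ (oneL2 n) (divCLM n v) = 0 := by
  rw [divCLM_apply, inner_sum]
  refine Finset.sum_eq_zero fun i _ => ?_
  rw [inner_oneL2, (isWeakPartial_grad v i i).integral_eq_zero]

/-- Weak derivatives have zero mean, so the gradient of an `H²_per` function always lies in
`H¹_{per,0}`. Testing with `φ` thus amounts to testing with gradient fields `v`. -/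
theorem isVeryWeakSolution_iff {n : ℕ} {A : (Fin n → ℝ) → Matrix (Fin n) (Fin n) ℝ}
    {b : (Fin n → ℝ) → Fin n → ℝ} {T : H1perZero n →L[ℝ] L2per n}
    (hT : ∀ w, T w =ᵐ[cellMeasure n] firstOrderTerm A b (grad w) (comp w)) (r : L2per n) :
    IsVeryWeakSolution A b r ↔ ∀ (φ : L2per n) (v : H1perZero n),
      (∀ i, IsWeakPartial i φ (comp v i)) → inner ℝ r (T v) = 0 := by
  have h : ∀ v, inner ℝ r (T v) =
      ∫ x in unitCell n, r x * firstOrderTerm A b (grad v) (comp v) x := by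
    intro v
    rw [inner_eq_integral]
    refine integral_congr_ae ?_
    filter_upwards [hT v] with x hx
    rw [hx]
  refine ⟨fun hr φ v hφ => ?_, fun hr φ p H hp hH => ?_⟩
  · rw [h]
    exact hr φ (comp v) (grad v) hφ (isWeakPartial_grad v)
  · have h1 := hr φ (mkH1perZero p H hH fun i => (hp i).integral_eq_zero) hp
    rwa [h] at h1

/-- A Hessian is symmetric, so the skew part of the form drops out against gradients. This links the
equation for `ρ` to the very weak formulation. -/
theorem bilinForm_eq_of_gradient {n : ℕ} {A : (Fin n → ℝ) → Matrix (Fin n) (Fin n) ℝ}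
    {b : (Fin n → ℝ) → Fin n → ℝ} {T : H1perZero n →L[ℝ] L2per n}
    (hT : ∀ w, T w =ᵐ[cellMeasure n] firstOrderTerm A b (grad w) (comp w))
    (v : H1perZero n) {φ : L2per n} {w : H1perZero n}
    (hφ : ∀ i, IsWeakPartial i φ (comp w i)) :
    bilinForm A b v w = inner ℝ (divCLM n v) (T w) := by
  have h : ∀ i j, grad w i j - grad w j i = 0 := fun i j =>
    sub_eq_zero.2 (grad_symm_of_isWeakPartial hφ i j)
  rw [bilinForm_eq_inner hT]
  simp [h]

/-- The Lax–Milgram theorem: unique solvability of `a(ρ, ·) = f`. -/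
theorem exists_laxMilgram {V : Type*} [NormedAddCommGroup V] [InnerProductSpace ℝ V]
    [CompleteSpace V] {a : V → V → ℝ} (ha : IsBoundedBilinearMap ℝ fun q : V × V => a q.1 q.2)
    {c : ℝ} (hc : 0 < c) (hcoer : ∀ w, c * ‖w‖ ^ 2 ≤ a w w) {f : V → ℝ}
    (hf : IsBoundedLinearMap ℝ f) : ∃ ρ, ∀ ρ', (∀ w, a ρ' w = f w) ↔ ρ' = ρ := by
  have hB : IsCoercive ha.toContinuousLinearMap := ⟨c, hc, fun w => by
    rw [mul_assoc, ← sq]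
    exact hcoer w⟩
  have haB : ∀ v w, ha.toContinuousLinearMap v w = a v w := fun _ _ => rfl
  set z := (InnerProductSpace.toDual ℝ V).symm hf.toContinuousLinearMap
  have hzf : ∀ w, inner ℝ z w = f w := fun w => InnerProductSpace.toDual_symm_apply
  refine ⟨hB.continuousLinearEquivOfBilin.symm z, fun ρ' => ⟨fun h => ?_, ?_⟩⟩
  · rw [hB.unique_continuousLinearEquivOfBilin fun w => (hzf w).trans (h w).symm]
    simp
  · rintro rfl w
    rw [← haB, ← hB.continuousLinearEquivOfBilin_apply, ContinuousLinearEquiv.apply_symm_apply,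
      hzf]

/-- If `B(ρ, w) = ∫_Y (A : Dw + b · w)` for all `w`, then `1 - ∇·ρ` is the only very weak solution
of unit mean. -/
theorem isVeryWeakSolution_iff_ae_eq {n : ℕ} {A : (Fin n → ℝ) → Matrix (Fin n) (Fin n) ℝ}
    {b : (Fin n → ℝ) → Fin n → ℝ} {T : H1perZero n →L[ℝ] L2per n}
    (hT : ∀ w, T w =ᵐ[cellMeasure n] firstOrderTerm A b (grad w) (comp w)) {c : ℝ} (hc : 0 < c)
    (hcoer : ∀ w : H1perZero n, c * ‖w‖ ^ 2 ≤ bilinForm A b w w) {ρ : H1perZero n}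
    (hρ : ∀ w, bilinForm A b ρ w =
      ∫ x in unitCell n, firstOrderTerm A b (grad w) (comp w) x) (r : L2per n) :
    (IsVeryWeakSolution A b r ∧ (∫ x in unitCell n, r x) = 1) ↔
      r =ᵐ[cellMeasure n] fun x => 1 - div ρ x := by
  have hBρ : ∀ w, bilinForm A b ρ w = inner ℝ (oneL2 n) (T w) := fun w => by
    rw [hρ, inner_oneL2, integral_congr_ae (hT w)]
  have hsol : IsVeryWeakSolution A b (oneL2 n - divCLM n ρ) :=
    (isVeryWeakSolution_iff hT _).2 fun φ v hφ => by
      rw [inner_sub_left, ← bilinForm_eq_of_gradient hT ρ hφ, hBρ, sub_self]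
  have hmean : inner ℝ (oneL2 n) (oneL2 n - divCLM n ρ) = 1 := by
    rw [inner_sub_right, inner_oneL2_self, inner_oneL2_divCLM, sub_zero]
  have hae : (oneL2 n - divCLM n ρ : L2per n) =ᵐ[cellMeasure n] fun x => 1 - div ρ x := by
    filter_upwards [Lp.coeFn_sub (oneL2 n) (divCLM n ρ), coeFn_oneL2 n, coeFn_divCLM ρ]
      with x h1 h2 h3
    rw [h1, Pi.sub_apply, h2, h3]
  rw [← inner_oneL2]
  constructor
  · rintro ⟨hr, hr1⟩
    -- The two solutions have equal mean, so their difference is `Δφ = ∇·v` with `v = ∇φ`. Both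
    -- annihilate `T v`, whence `B(v,v) = ⟨∇·v, T v⟩ = 0`.
    obtain ⟨φ, v, hφ, hv⟩ := exists_poisson (r - (oneL2 n - divCLM n ρ)) (by
      rw [← inner_oneL2, inner_sub_right, hr1, hmean, sub_self])
    rw [← divCLM_apply] at hv
    have h0 : bilinForm A b v v = 0 := by
      rw [bilinForm_eq_of_gradient hT v hφ, hv, inner_sub_left,
        (isVeryWeakSolution_iff hT _).1 hr φ v hφ, (isVeryWeakSolution_iff hT _).1 hsol φ v hφ,
        sub_zero]
    have hv0 : v = 0 := by
      have h1 := hcoer v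
      rw [h0] at h1
      have h2 : ‖v‖ ^ 2 ≤ 0 := nonpos_of_mul_nonpos_right h1 hc
      exact norm_eq_zero.1 (pow_eq_zero_iff two_ne_zero |>.1 (le_antisymm h2 (sq_nonneg _)))
    rw [hv0, map_zero] at hv
    rw [sub_eq_zero.1 hv.symm]
    exact hae
  · intro hr
    obtain rfl : r = oneL2 n - divCLM n ρ := Lp.ext (hr.trans hae.symm)
    exact ⟨hsol, hmean⟩

/-- Boundedness, coercivity, unique solvability and the very weak solution for coefficients sufficiently close to `(I, 0)`. -/
theorem IsNearIdentity.exists_unique_solution {n : ℕ} (hn : 0 < n)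
    {A : (Fin n → ℝ) → Matrix (Fin n) (Fin n) ℝ}
    {b : (Fin n → ℝ) → Fin n → ℝ} {ε : ℝ} (h : IsNearIdentity A b ε) (hε : 0 ≤ ε)
    (hε' : ε < Real.pi ^ 2 / (n + Real.pi ^ 2)) :
    IsBoundedBilinearMap ℝ (fun q : H1perZero n × H1perZero n => bilinForm A b q.1 q.2) ∧
    (∃ c : ℝ, 0 < c ∧ ∀ w : H1perZero n, c * ‖w‖ ^ 2 ≤ bilinForm A b w w) ∧
    ∃ ρ : H1perZero n,
      (∀ ρ' : H1perZero n, (∀ w : H1perZero n, bilinForm A b ρ' w =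
        ∫ x in unitCell n, firstOrderTerm A b (grad w) (comp w) x) ↔ ρ' = ρ) ∧
      ∀ r : L2per n, (IsVeryWeakSolution A b r ∧ (∫ x in unitCell n, r x) = 1) ↔
        r =ᵐ[cellMeasure n] fun x => 1 - div ρ x := by
  obtain ⟨T, hT⟩ := h.exists_firstOrderCLM
  obtain ⟨B, hB⟩ := exists_bilinCLM hT
  obtain ⟨c, hc, hcoer⟩ := h.coercive hn hε hε'
  have hbil : IsBoundedBilinearMap ℝ
      (fun q : H1perZero n × H1perZero n => bilinForm A b q.1 q.2) := by
    have h1 := B.isBoundedBilinearMap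
    simp only [hB] at h1
    exact h1
  have hf : IsBoundedLinearMap ℝ fun w : H1perZero n =>
      ∫ x in unitCell n, firstOrderTerm A b (grad w) (comp w) x := by
    have h2 : (fun w : H1perZero n =>
        ∫ x in unitCell n, firstOrderTerm A b (grad w) (comp w) x) =
        (innerSL ℝ (oneL2 n)).comp T := funext fun w =>
      ((inner_oneL2 (T w)).trans (integral_congr_ae (hT w))).symm
    rw [h2]
    exact ((innerSL ℝ (oneL2 n)).comp T).isBoundedLinearMap
  obtain ⟨ρ, hρ⟩ := exists_laxMilgram hbil hc hcoer hf
  exact ⟨hbil, ⟨c, hc, hcoer⟩, ρ, hρ,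
    isVeryWeakSolution_iff_ae_eq hT hc hcoer ((hρ ρ).2 rfl)⟩

end PeriodicFPK

end

theorem lemma2p11 (n : ℕ) (hn : 0 < n)
    (A : (Fin n → ℝ) → Matrix (Fin n) (Fin n) ℝ) (b : (Fin n → ℝ) → Fin n → ℝ)
    (hAb : PeriodicFPK.SettingB A b) :
    -- boundedness and bilinearity
    IsBoundedBilinearMap ℝ (fun q : PeriodicFPK.H1perZero n × PeriodicFPK.H1perZero n =>
      PeriodicFPK.bilinForm (PeriodicFPK.renormA A b) (PeriodicFPK.renormb A b) q.1 q.2) ∧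
    -- coercivity
    (∃ c : ℝ, 0 < c ∧ ∀ w : PeriodicFPK.H1perZero n,
      c * ‖w‖ ^ 2 ≤
        PeriodicFPK.bilinForm (PeriodicFPK.renormA A b) (PeriodicFPK.renormb A b) w w) ∧
    -- existence and uniqueness of `ρ`, and the characterization of the solution `r`
    ∃ ρ : PeriodicFPK.H1perZero n,
      (∀ ρ' : PeriodicFPK.H1perZero n,
        (∀ w : PeriodicFPK.H1perZero n,
          PeriodicFPK.bilinForm (PeriodicFPK.renormA A b) (PeriodicFPK.renormb A b) ρ' w =
            ∫ x in PeriodicFPK.unitCell n,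
              PeriodicFPK.firstOrderTerm (PeriodicFPK.renormA A b) (PeriodicFPK.renormb A b)
                (PeriodicFPK.grad w) (PeriodicFPK.comp w) x) ↔ ρ' = ρ) ∧
      ∀ r : PeriodicFPK.L2per n,
        (PeriodicFPK.IsVeryWeakSolution (PeriodicFPK.renormA A b) (PeriodicFPK.renormb A b) r ∧
          (∫ x in PeriodicFPK.unitCell n, r x) = 1) ↔
        r =ᵐ[MeasureTheory.volume.restrict (PeriodicFPK.unitCell n)] fun x => 1 - PeriodicFPK.div ρ x := by
  obtain ⟨ε, hε, hε', hnear⟩ := hAb.isNearIdentity hn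
  exact hnear.exists_unique_solution hn hε hε'
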